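/- Let $\mathcal X\subset\mathbb R^d$ be a set with its subspace topology and Borel $\sigma$-algebra, let $\rho$ be a probability measure on $\mathcal X\times\{-1,1\}$ with marginal $\rho_{\mathcal X}$ on $\mathcal X$ and conditional probability $\rho(1|x)$, and let $(X,Y)\sim\rho$. Let $\mathcal H$ be the reproducing kernel Hilbert space on $\mathcal X$ of the Gaussian kernel $k(x,x')=\exp(-\|x-x'\|^2/(2s^2))$, $s>0$. Let $l(\zeta,y)=\log(1+e^{-y\zeta})$ be the logistic loss, and put $\mathcal L(f)=\mathbb E[l(f(X),Y)]$ and $\mathcal R(f)=\mathbb P(\operatorname{sgn}(f(X))\ne Y)$ for measurable $f:\mathcal X\to\mathbb R$, and $\mathcal L_\lambda(g)=\mathcal L(g)+\frac\lambda2\|g\|_{\mathcal H}^2$ for $g\in\mathcal H$ and $\lambda>0$. Assume: - $\mathcal L$ is $L$-smooth on $\mathcal H$ for some $L>0$, i.e. $|\mathcal L(g+h)-\mathcal L(g)-\langle\nabla\mathcal L(g),h\rangle_{\mathcal H}|\le\frac L2\|h\|_{\mathcal H}^2$ for all $g,h\in\mathcal H$; - $\operatorname{supp}(\rho_{\mathcal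 X})=\mathcal X$; - $\delta\in(0,1/2)$ and $|\rho(1|x)-\frac12|>\delta$ for $\rho_{\mathcal X}$-almost every $x$; - $\rho(1|x)\in(0,1)$ for $\rho_{\mathcal X}$-almost every $x$; - some $g_*\in\mathcal H$ minimizes $\mathcal L$ over all measurable functions $\mathcal X\to\mathbb R$. Then for all sufficiently small $\lambda>0$ (i.e. there is $\lambda_0>0$, depending on the above data, such that for all $\lambda\in(0,\lambda_0]$) the following holds. $\mathcal L_\lambda$ has a unique minimizer $g_\lambda$ in $\mathcal H$. Let $\gamma>0$ and $\eta_t=\frac{2}{\lambda(\gamma+t)}$ be such that $\eta_1\le\min\{\frac1L,\frac1{2\lambda}\}$, let $g_1\in\mathcal H$ with $\|g_1\|_{\mathcal H}\le 2\eta_1+\frac1\lambda$, and let $T\ge 0$ be an integer such that $$\max\left\{\frac{36}{\lambda^2(2\gamma+T)},\ \frac{\gamma(\gamma-1)\|g_1-g_\lambda\|_{\mathcal H}^2}{(2\gamma+T)(T+1)}\right\}\le\frac1{32}\log^2\left(\frac{1+2\delta}{1-2\delta}\right).$$ Let $(x_1,y_1),(x_2,y_2),\dots$ be independent with law $\rho$,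 run stochastic gradient descent $$g_{t+1}=g_t-\eta_t\bigl(\partial_\zeta l(g_t(x_t),y_t)\,k(x_t,\cdot)+\lambda g_t\bigr),\qquad t=1,\dots,T,$$ and let $\overline g_{T+1}=\sum_{t=1}^{T+1}\frac{2(\gamma+t-1)}{(2\gamma+T)(T+1)}\,g_t$ be the averaged iterate. Then the excess classification error of $\overline g_{T+1}$ over the Bayes classifier $x\mapsto\mathbb E[Y|x]$ is integrable and $$\mathbb E\bigl[\mathcal R(\overline g_{T+1})-\mathcal R(\mathbb E[Y|x])\bigr]\le 2\exp\left(-\frac{\lambda^2(2\gamma+T)}{2^{10}\cdot 9}\log^2\left(\frac{1+2\delta}{1-2\delta}\right)\right).$$ -/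

import Mathlib

open MeasureTheory ProbabilityTheory
open scoped InnerProductSpace

noncomputable section

/-- The set of binary labels `{-1, 1}`. -/
abbrev Label : Type := ({-1, 1} : Set ℝ)

/-- The label `1`. -/
def posLabel : Label := ⟨1, by simp⟩

/-- The logistic function `φ(v) = log (1 + exp (-v))`. -/
def logistic (v : ℝ) : ℝ := Real.log (1 + Real.exp (-v))

/-- The logistic loss `l(ζ, y) = φ(y ζ)`. -/
def logisticLoss (ζ y : ℝ) : ℝ := logistic (y * ζ)

/-- The derivative `∂_ζ l(ζ, y)` of the logistic loss in its first variable. -/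
def logisticLossDeriv (ζ y : ℝ) : ℝ := deriv (fun s => logisticLoss s y) ζ

/-- The Gaussian kernel of bandwidth `s`. -/
def gaussianKernel {E : Type*} [NormedAddCommGroup E] (s : ℝ) (x x' : E) : ℝ :=
  Real.exp (-‖x - x'‖ ^ 2 / (2 * s ^ 2))

section Risk

variable {X : Type*} [MeasurableSpace X]

/-- The conditional probability `ρ(1 | x)`. -/
def condProbOne (ρ : Measure (X × Label)) [IsFiniteMeasure ρ] (x : X) : ℝ :=
  (ρ.condKernel x).real {posLabel}

/-- The conditional expectation `E[Y | x]`. -/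
def condMean (ρ : Measure (X × Label)) [IsFiniteMeasure ρ] (x : X) : ℝ :=
  ∫ y, (y : ℝ) ∂(ρ.condKernel x)

/-- The expected classification error `R(f) = P(sgn (f(X)) ≠ Y)`. -/
def classError (ρ : Measure (X × Label)) (f : X → ℝ) : ℝ :=
  ρ.real {z | Real.sign (f z.1) ≠ (z.2 : ℝ)}

/-- The expected risk `L(f) = E[l(f(X), Y)]` of the logistic loss. It is to be used for `f` whose
loss is integrable; all other measurable `f` have infinite risk, the loss being nonnegative. -/
def risk (ρ : Measure (X × Label)) (f : X → ℝ) : ℝ :=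
  ∫ z, logisticLoss (f z.1) z.2 ∂ρ

/-- `f` is a Bayes rule for the expected risk: it minimizes the risk over all measurable functions.
Competitors with non-integrable loss have risk `+∞` and need not be compared. -/
def IsBayesRule (ρ : Measure (X × Label)) (f : X → ℝ) : Prop :=
  Measurable f ∧ Integrable (fun z => logisticLoss (f z.1) z.2) ρ ∧
    ∀ f' : X → ℝ, Measurable f' → Integrable (fun z => logisticLoss (f' z.1) z.2) ρ →
      risk ρ f ≤ risk ρ f'

end Risk

section SGD

variable {X H : Type*} [NormedAddCommGroup H] [InnerProductSpace ℝ H] [RKHS ℝ H X ℝ]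

/-- The regularized risk `L_lam(g) = L(g) + (lam / 2) ‖g‖²` on a reproducing kernel Hilbert
space. -/
def regRisk [MeasurableSpace X] (ρ : Measure (X × Label)) (lam : ℝ) (g : H) : ℝ :=
  risk ρ (g : X → ℝ) + lam / 2 * ‖g‖ ^ 2

/-- The expected risk is `L`-smooth on the reproducing kernel Hilbert space `H`. -/
def RiskSmooth [MeasurableSpace X] (H : Type*) [NormedAddCommGroup H] [InnerProductSpace ℝ H]
    [RKHS ℝ H X ℝ] [CompleteSpace H] (ρ : Measure (X × Label)) (L : ℝ) : Prop :=
  ∀ g h : H, |risk ρ ((g + h : H) : X → ℝ) - risk ρ (g : X → ℝ)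
    - ⟪gradient (fun f : H => risk ρ (f : X → ℝ)) g, h⟫_ℝ| ≤ L / 2 * ‖h‖ ^ 2

/-- The stochastic gradient `G_lam(g, (x, y)) = ∂_ζ l(g(x), y) k(x, ·) + lam g`. -/
def stochGrad [CompleteSpace H] (lam : ℝ) (g : H) (z : X × Label) : H :=
  logisticLossDeriv (g z.1) z.2 • RKHS.kerFun H z.1 1 + lam • g

/-- The learning rate `η_t = 2 / (lam (γ + t))`. -/
def learningRate (lam γ : ℝ) (t : ℕ) : ℝ := 2 / (lam * (γ + t))

/-- The averaging weight `α_t = 2 (γ + t - 1) / ((2 γ + T) (T + 1))`. -/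
def avgWeight (γ : ℝ) (T t : ℕ) : ℝ := 2 * (γ + t - 1) / ((2 * γ + T) * (T + 1))

/-- The iterates of stochastic gradient descent started at `g₁` and run on the samples
`z 1, z 2, …`. The value at `s` is the iterate `g_{s + 1}`. -/
def sgdIterate [CompleteSpace H] (lam γ : ℝ) (g₁ : H) (z : ℕ → X × Label) : ℕ → H
  | 0 => g₁
  | s + 1 => sgdIterate lam γ g₁ z s
      - learningRate lam γ (s + 1) • stochGrad lam (sgdIterate lam γ g₁ z s) (z (s + 1))

/-- The output `∑_{t = 1}^{T + 1} α_t g_t` of averaged stochastic gradient descent. -/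
def averagedSGD [CompleteSpace H] (lam γ : ℝ) (g₁ : H) (z : ℕ → X × Label) (T : ℕ) : H :=
  ∑ s ∈ Finset.range (T + 1), avgWeight γ T (s + 1) • sgdIterate lam γ g₁ z s

end SGD

end

/-! Write m = log((1+2δ)/(1-2δ)). The kernel sections have norm one, so the norm of H dominates the
sup norm. By Gibbs' inequality a bounded Bayes rule of the logistic risk equals the log-odds almost
everywhere, and the low-noise condition then pushes its values outside [-m, m] with the sign of
E[Y|x] (`IsBayesRule.ae_margin`). Hence any function within m of a Bayes rule g₀ in H has zero
excess error. Since the excess error never exceeds 1, its expectation is at most the probability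
that the averaged iterate leaves this ball. The distance m is split as m/2 + m/4 + m/4.

Approximation (m/2): as λ → 0 the minimizers g_λ converge in norm to a Bayes rule g₀
(`exists_isBayesRule_forall_isMinOn_dist_le`).

Bias (m/4): the mean V of the averaged iterate is close to g_λ, by the usual one-step inequality for
strongly convex SGD, averaged with weights for which it telescopes
(`norm_futureMean_sgdChain_sub_smul_sq_le`).

Fluctuation (m/4): the averaged iterate minus V is the endpoint of a Doob martingale in H, and a
Pinelis-type Hoeffding inequality applies (`measureReal_norm_weightedSum_sub_ge_le`). Its increments
are controlled by the sensitivity of the conditional mean to one sample. A step of rate η ≤ 1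
contracts by 1 - ηλ, which bounds the increments by 8/(λ(2γ+T)). Steps with η > 1 are controlled
only up to an additive error η; there are O(1/λ) of them, and when they occur T is at least of order
1/λ², so for small λ they cost only a constant (`sum_sgdInfluence_sq_le`). -/

noncomputable section

/-! ### The logistic loss: convexity, derivative and Lipschitz bounds. -/

section Logistic

theorem Label.eq_one_or_neg_one (y : Label) : (y : ℝ) = 1 ∨ (y : ℝ) = -1 := by
  obtain ⟨y, hy⟩ := y
  simp only [Set.mem_insert_iff, Set.mem_singleton_iff] at hy
  tauto

theorem Label.mul_self (y : Label) : (y : ℝ) * y = 1 := by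
  rcases y.eq_one_or_neg_one with h | h <;> rw [h] <;> norm_num

theorem Label.abs_eq_one (y : Label) : |(y : ℝ)| = 1 := by
  rcases y.eq_one_or_neg_one with h | h <;> rw [h] <;> norm_num

theorem Real.exists_sigmoid_sub_eq (p q : ℝ) :
    ∃ a ∈ Set.Icc (0 : ℝ) 1, Real.sigmoid p - Real.sigmoid q = a * (p - q) := by
  wlog h : q ≤ p generalizing p q
  · obtain ⟨a, ha, h'⟩ := this q p (le_of_not_ge h)
    exact ⟨a, ha, by linarith⟩
  rcases h.eq_or_lt with h | h
  · exact ⟨0, by simp, by simp [h]⟩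
  · obtain ⟨c, -, hc⟩ := exists_deriv_eq_slope Real.sigmoid h
      continuous_sigmoid.continuousOn differentiable_sigmoid.differentiableOn
    refine ⟨deriv Real.sigmoid c, ?_, ?_⟩
    · rw [Real.deriv_sigmoid]
      have h1 := Real.sigmoid_pos c
      have h2 := Real.sigmoid_lt_one c
      constructor <;> nlinarith
    · rw [hc]
      have : p - q ≠ 0 := by linarith
      field_simp

theorem hasDerivAt_logistic (v : ℝ) : HasDerivAt logistic (-Real.sigmoid (-v)) v := by
  have h1 : HasDerivAt (fun v : ℝ => 1 + Real.exp (-v)) (Real.exp (-v) * -1) v :=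
    ((hasDerivAt_neg v).exp).const_add 1
  have h2 := h1.log (by positivity)
  refine h2.congr_deriv ?_
  rw [← Real.sigmoid_mul_rexp_neg, Real.sigmoid_def]
  field_simp

theorem convexOn_logistic : ConvexOn ℝ Set.univ logistic := by
  have hd : deriv logistic = fun v => -Real.sigmoid (-v) :=
    funext fun v => (hasDerivAt_logistic v).deriv
  refine Monotone.convexOn_univ_of_deriv (fun v => (hasDerivAt_logistic v).differentiableAt) ?_
  rw [hd]
  intro a b hab
  simpa using Real.sigmoid_le (neg_le_neg hab)

theorem logistic_tangent_le (v w : ℝ) :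
    logistic v + -Real.sigmoid (-v) * (w - v) ≤ logistic w := by
  rcases lt_trichotomy v w with h | h | h
  · have := convexOn_logistic.le_slope_of_hasDerivAt (Set.mem_univ v) (Set.mem_univ w) h
      (hasDerivAt_logistic v)
    rw [slope_def_field, le_div_iff₀ (by linarith)] at this
    linarith
  · simp [h]
  · have := convexOn_logistic.slope_le_of_hasDerivAt (Set.mem_univ w) (Set.mem_univ v) h
      (hasDerivAt_logistic v)
    rw [slope_def_field, div_le_iff₀ (by linarith)] at this
    linarith

theorem logistic_nonneg (v : ℝ) : 0 ≤ logistic v :=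
  Real.log_nonneg (by linarith [Real.exp_pos (-v)])

theorem abs_logistic_sub_le (v w : ℝ) : |logistic v - logistic w| ≤ |v - w| := by
  have key : ∀ a b, logistic a - logistic b ≤ |a - b| := fun a b => by
    have h1 := logistic_tangent_le a b
    have h2 := Real.sigmoid_nonneg (-a)
    have h3 := Real.sigmoid_le_one (-a)
    have h4 : Real.sigmoid (-a) * (b - a) ≤ |a - b| := by
      rcases le_total a b with h | h
      · rw [abs_sub_comm, abs_of_nonneg (by linarith)]; nlinarith
      · rw [abs_of_nonneg (by linarith)]; nlinarith
    linarith
  rw [abs_sub_le_iff]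
  exact ⟨key v w, by simpa [abs_sub_comm] using key w v⟩

theorem continuous_logistic : Continuous logistic :=
  continuous_iff_continuousAt.2 fun v => (hasDerivAt_logistic v).continuousAt

theorem logisticLossDeriv_eq (ζ y : ℝ) :
    logisticLossDeriv ζ y = -Real.sigmoid (-(y * ζ)) * y := by
  have h : HasDerivAt (fun s : ℝ => y * s) y ζ := by
    simpa using (hasDerivAt_id ζ).const_mul y
  exact ((hasDerivAt_logistic (y * ζ)).comp ζ h).deriv

theorem abs_logisticLossDeriv_le (ζ : ℝ) (y : Label) : |logisticLossDeriv ζ y| ≤ 1 := by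
  rw [logisticLossDeriv_eq, abs_mul, y.abs_eq_one, abs_neg,
    abs_of_nonneg (Real.sigmoid_nonneg _), mul_one]
  exact Real.sigmoid_le_one _

theorem abs_logisticLossDeriv_sub_le (ζ ζ' : ℝ) (y : Label) :
    |logisticLossDeriv ζ y - logisticLossDeriv ζ' y| ≤ 1 := by
  rw [logisticLossDeriv_eq, logisticLossDeriv_eq, ← sub_mul, abs_mul, y.abs_eq_one, mul_one,
    abs_le]
  have h1 := Real.sigmoid_nonneg (-(y * ζ))
  have h2 := Real.sigmoid_le_one (-(y * ζ))
  have h3 := Real.sigmoid_nonneg (-(y * ζ'))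
  have h4 := Real.sigmoid_le_one (-(y * ζ'))
  constructor <;> linarith

/-- Beyond a Lipschitz bound, the factor `a ≥ 0` records monotonicity of the derivative; the
contraction estimate for a gradient step needs both. -/
theorem exists_logisticLossDeriv_sub_eq (ζ ζ' : ℝ) (y : Label) :
    ∃ a ∈ Set.Icc (0 : ℝ) 1,
      logisticLossDeriv ζ y - logisticLossDeriv ζ' y = a * (ζ - ζ') := by
  obtain ⟨a, ha, h⟩ := Real.exists_sigmoid_sub_eq (-(y * ζ)) (-(y * ζ'))
  refine ⟨a, ha, ?_⟩
  rw [logisticLossDeriv_eq, logisticLossDeriv_eq]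
  linear_combination -(y : ℝ) * h + a * (ζ - ζ') * y.mul_self

theorem continuous_logisticLoss : Continuous fun p : ℝ × ℝ => logisticLoss p.1 p.2 :=
  continuous_logistic.comp (by fun_prop)

theorem continuous_logisticLossDeriv : Continuous fun p : ℝ × ℝ => logisticLossDeriv p.1 p.2 := by
  simp_rw [logisticLossDeriv_eq]
  have := continuous_sigmoid
  fun_prop

theorem logisticLoss_nonneg (ζ y : ℝ) : 0 ≤ logisticLoss ζ y := logistic_nonneg _

theorem logisticLoss_tangent_le (ζ ζ' y : ℝ) :
    logisticLoss ζ y + logisticLossDeriv ζ y * (ζ' - ζ) ≤ logisticLoss ζ' y := by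
  have := logistic_tangent_le (y * ζ) (y * ζ')
  rw [logisticLossDeriv_eq]
  unfold logisticLoss
  linarith

theorem abs_logisticLoss_sub_le (ζ ζ' : ℝ) (y : Label) :
    |logisticLoss ζ y - logisticLoss ζ' y| ≤ |ζ - ζ'| := by
  have := abs_logistic_sub_le (y * ζ) (y * ζ')
  rwa [← mul_sub, abs_mul, y.abs_eq_one, one_mul] at this

theorem logisticLoss_convex (ζ ζ' y : ℝ) {a b : ℝ} (ha : 0 ≤ a) (hb : 0 ≤ b) (hab : a + b = 1) :
    logisticLoss (a * ζ + b * ζ') y ≤ a * logisticLoss ζ y + b * logisticLoss ζ' y := by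
  have := convexOn_logistic.2 (Set.mem_univ (y * ζ)) (Set.mem_univ (y * ζ')) ha hb hab
  simp only [smul_eq_mul] at this
  unfold logisticLoss
  rwa [show y * (a * ζ + b * ζ') = a * (y * ζ) + b * (y * ζ') by ring]

end Logistic

/-! ### A Hoeffding lemma for the norm in a Hilbert space. -/

section HilbertHoeffding

/-- The power series of cosh has only even powers, so this is a power series in u with nonnegative
coefficients. -/
theorem convexOn_cosh_sqrt : ConvexOn ℝ (Set.Ici 0) fun u : ℝ => Real.cosh √u := by
  have key : ∀ u : ℝ, 0 ≤ u →
      HasSum (fun n : ℕ => u ^ n / (2 * n).factorial) (Real.cosh √u) := fun u hu => by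
    have := Real.hasSum_cosh √u
    simpa only [pow_mul, Real.sq_sqrt hu] using this
  refine ⟨convex_Ici 0, fun x hx y hy a b ha hb hab => ?_⟩
  have hx' : 0 ≤ x := hx
  have hy' : 0 ≤ y := hy
  have hxy : 0 ≤ a * x + b * y := by positivity
  refine hasSum_le (fun n => ?_) (key _ hxy)
    (((key x hx).mul_left a).add ((key y hy).mul_left b))
  have := (convexOn_pow n).2 hx hy ha hb hab
  simp only [smul_eq_mul] at this ⊢
  rw [← mul_div_assoc, ← mul_div_assoc, ← add_div]
  gcongr

variable {H : Type*} [NormedAddCommGroup H] [InnerProductSpace ℝ H]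

/-- The point of this form is that the right side is affine in `d`: a centered `d` contributes only
the factor `cosh c`. -/
theorem cosh_norm_add_le (x d : H) {c : ℝ} (hd : ‖d‖ ≤ c) :
    Real.cosh ‖x + d‖ ≤ Real.cosh ‖x‖ * Real.cosh c
      + ⟪x, d⟫_ℝ * (Real.sinh ‖x‖ * Real.sinh c / (‖x‖ * c)) := by
  have hc : 0 ≤ c := (norm_nonneg d).trans hd
  rcases hc.eq_or_lt with rfl | hc
  · have : d = 0 := norm_le_zero_iff.1 hd
    simp [this]
  rcases eq_or_ne x 0 with rfl | hx
  · simpa [abs_of_pos hc] using hd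
  set r := ‖x‖ with hr
  have hrpos : 0 < r := norm_pos_iff.2 hx
  set s := ⟪x, d⟫_ℝ
  have hs : |s| ≤ r * c := (abs_real_inner_le_norm x d).trans (by gcongr)
  have hrc : 0 < r * c := by positivity
  have hs1 : s / (r * c) ≤ 1 := by rw [div_le_one hrc]; exact (abs_le.1 hs).2
  have hs2 : -1 ≤ s / (r * c) := by rw [le_div_iff₀ hrc]; linarith [(abs_le.1 hs).1]
  -- The bound r² + 2⟪x, d⟫ + c² for the squared norm is the convex combination of (r - c)² and (r +
  -- c)² with these weights; convexity of cosh √u and the addition formulas then give the claim.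
  have h1 : ‖x + d‖ ≤ √((1 - s / (r * c)) / 2 * (r - c) ^ 2 + (1 + s / (r * c)) / 2 * (r + c) ^ 2) := by
    apply Real.le_sqrt_of_sq_le
    rw [norm_add_sq_real]
    have h3 : (1 - s / (r * c)) / 2 * (r - c) ^ 2 + (1 + s / (r * c)) / 2 * (r + c) ^ 2
        = r ^ 2 + 2 * s + c ^ 2 := by
      field_simp
      ring
    rw [h3]
    have : ‖d‖ ^ 2 ≤ c ^ 2 := by gcongr
    linarith
  have h2 := convexOn_cosh_sqrt.2 (Set.mem_Ici.2 (sq_nonneg (r - c)))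
    (Set.mem_Ici.2 (sq_nonneg (r + c)))
    (show 0 ≤ (1 - s / (r * c)) / 2 by linarith) (show 0 ≤ (1 + s / (r * c)) / 2 by linarith)
    (by ring)
  simp only [smul_eq_mul] at h2
  have h4 : Real.cosh ‖x + d‖ ≤ Real.cosh
      √((1 - s / (r * c)) / 2 * (r - c) ^ 2 + (1 + s / (r * c)) / 2 * (r + c) ^ 2) := by
    rw [Real.cosh_le_cosh, abs_of_nonneg (norm_nonneg _), abs_of_nonneg (Real.sqrt_nonneg _)]
    exact h1
  refine h4.trans (h2.trans_eq ?_)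
  rw [Real.sqrt_sq_eq_abs, Real.sqrt_sq_eq_abs, Real.cosh_abs, Real.cosh_abs, Real.cosh_sub,
    Real.cosh_add]
  ring

theorem integral_cosh_norm_add_le [CompleteSpace H] {𝒵 : Type*} [MeasurableSpace 𝒵] (μ : Measure 𝒵)
    [IsProbabilityMeasure μ] (x : H) {D : 𝒵 → H} (hD : Integrable D μ) (hmean : ∫ z, D z ∂μ = 0)
    {c : ℝ} (hc : ∀ z, ‖D z‖ ≤ c) :
    Integrable (fun z => Real.cosh ‖x + D z‖) μ ∧
      ∫ z, Real.cosh ‖x + D z‖ ∂μ ≤ Real.cosh ‖x‖ * Real.exp (c ^ 2 / 2) := by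
  have hint : Integrable (fun z => Real.cosh ‖x + D z‖) μ := by
    refine Integrable.of_bound (Real.continuous_cosh.comp_aestronglyMeasurable
      (hD.aestronglyMeasurable.const_add x).norm) (Real.cosh (‖x‖ + c)) (ae_of_all _ fun z => ?_)
    have h0 : 0 ≤ c := (norm_nonneg _).trans (hc z)
    rw [Real.norm_eq_abs, abs_of_pos (Real.cosh_pos _), Real.cosh_le_cosh, abs_of_nonneg (norm_nonneg _),
      abs_of_nonneg (by positivity)]
    exact (norm_add_le _ _).trans (by gcongr; exact hc z)
  refine ⟨hint, ?_⟩
  have hi : Integrable (fun z => ⟪x, D z⟫_ℝ) μ := hD.const_inner x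
  have h0 : ∫ z, ⟪x, D z⟫_ℝ ∂μ = 0 := by rw [integral_inner hD, hmean, inner_zero_right]
  calc ∫ z, Real.cosh ‖x + D z‖ ∂μ
      ≤ ∫ z, (Real.cosh ‖x‖ * Real.cosh c
        + ⟪x, D z⟫_ℝ * (Real.sinh ‖x‖ * Real.sinh c / (‖x‖ * c))) ∂μ :=
        integral_mono hint ((integrable_const _).add (hi.mul_const _))
          fun z => cosh_norm_add_le x (D z) (hc z)
    _ = Real.cosh ‖x‖ * Real.cosh c := by
        rw [integral_add (integrable_const _) (hi.mul_const _), integral_const, integral_mul_const, h0]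
        simp
    _ ≤ _ := by
        gcongr
        exact Real.cosh_le_exp_half_sq c

end HilbertHoeffding

/-! ### Concentration of weighted sums along a Markov chain with independent inputs. -/

section MarkovAverage

variable {H 𝒵 : Type*} [NormedAddCommGroup H] [InnerProductSpace ℝ H]

/-- The conditional mean of `∑ j ∈ [s, s + r], w j • S j` given `S s = g`, for the Markov chain
`S (j + 1) = step j (S j) z` driven by independent samples `z` with law `μ`. -/
def futureMean [MeasurableSpace 𝒵] (μ : Measure 𝒵) (step : ℕ → H → 𝒵 → H) (w : ℕ → ℝ) :
    ℕ → ℕ → H → H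
  | 0, s, g => w s • g
  | r + 1, s, g => w s • g + ∫ z, futureMean μ step w r (s + 1) (step s g z) ∂μ

variable [MeasurableSpace 𝒵] {μ : Measure 𝒵} {step : ℕ → H → 𝒵 → H} {w : ℕ → ℝ}

@[simp]
theorem futureMean_zero (s : ℕ) (g : H) : futureMean μ step w 0 s g = w s • g := rfl

theorem futureMean_succ (r s : ℕ) (g : H) : futureMean μ step w (r + 1) s g
    = w s • g + ∫ z, futureMean μ step w r (s + 1) (step s g z) ∂μ := rfl

variable [MeasurableSpace H] [BorelSpace H] [SecondCountableTopology H] [IsProbabilityMeasure μ]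

theorem measurable_futureMean (hstep : ∀ s, Measurable fun p : H × 𝒵 => step s p.1 p.2)
    (r s : ℕ) : Measurable (futureMean μ step w r s) := by
  induction r generalizing s with
  | zero => exact measurable_id.const_smul (w s)
  | succ r ih =>
    have h : StronglyMeasurable fun p : H × 𝒵 => futureMean μ step w r (s + 1) (step s p.1 p.2) :=
      ((ih (s + 1)).comp (hstep s)).stronglyMeasurable
    exact (measurable_id.const_smul (w s)).add h.integral_prod_right.measurable

omit [InnerProductSpace ℝ H] in
theorem integrable_of_dist_le {f : 𝒵 → H} (hf : Measurable f) {c : ℝ}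
    (hc : ∀ z z', ‖f z - f z'‖ ≤ c) : Integrable f μ := by
  have : Nonempty 𝒵 := μ.nonempty_of_neZero
  let z₀ := Classical.arbitrary 𝒵
  refine Integrable.of_bound hf.aestronglyMeasurable (‖f z₀‖ + c) (ae_of_all _ fun z => ?_)
  calc ‖f z‖ = ‖f z₀ + (f z - f z₀)‖ := by rw [add_sub_cancel]
    _ ≤ _ := (norm_add_le _ _).trans (by gcongr; exact hc _ _)

variable {Ω : Type*} [MeasurableSpace Ω] {P : Measure Ω}
  {Z : ℕ → Ω → 𝒵} {S : ℕ → Ω → H} {g₁ : H}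

omit [NormedAddCommGroup H] [InnerProductSpace ℝ H] [BorelSpace H] [SecondCountableTopology H]
  [MeasurableSpace Ω] in
-- Adaptedness: since `S s` depends only on samples up to index `s`, the next sample `Z (s + 1)` is
-- independent of the past.
theorem measurable_iterate_iSup_comap (hstep : ∀ s, Measurable fun p : H × 𝒵 => step s p.1 p.2)
    (hS0 : ∀ ω, S 0 ω = g₁) (hS : ∀ s ω, S (s + 1) ω = step s (S s ω) (Z (s + 1) ω)) (s : ℕ) :
    Measurable[⨆ i ∈ {i | i ≤ s}, MeasurableSpace.comap (Z i) inferInstance] (S s) := by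
  induction s with
  | zero => rw [show S 0 = fun _ => g₁ from funext hS0]; exact measurable_const
  | succ s ih =>
    rw [show S (s + 1) = (fun p : H × 𝒵 => step s p.1 p.2) ∘ fun ω => (S s ω, Z (s + 1) ω) from
      funext (hS s)]
    refine (hstep s).comp (Measurable.prodMk (ih.mono ?_ le_rfl) ?_)
    · exact biSup_mono fun i (hi : i ≤ s) => hi.trans s.le_succ
    · exact (comap_measurable (Z (s + 1))).mono
        (le_biSup (fun i => MeasurableSpace.comap (Z i) inferInstance)
          (show s + 1 ∈ {i | i ≤ s + 1} from le_refl (s + 1))) le_rfl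

theorem indepFun_partialSum_iterate (hstep : ∀ s, Measurable fun p : H × 𝒵 => step s p.1 p.2)
    (hZm : ∀ t, Measurable (Z t)) (hZi : iIndepFun Z P)
    (hS0 : ∀ ω, S 0 ω = g₁) (hS : ∀ s ω, S (s + 1) ω = step s (S s ω) (Z (s + 1) ω)) (s : ℕ) :
    IndepFun (fun ω => (∑ j ∈ Finset.range s, w j • S j ω, S s ω)) (Z (s + 1)) P := by
  have hm := measurable_iterate_iSup_comap hstep hS0 hS
  have hind : Indep (⨆ i ∈ {i | i ≤ s}, MeasurableSpace.comap (Z i) inferInstance)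
      (⨆ i ∈ ({s + 1} : Set ℕ), MeasurableSpace.comap (Z i) inferInstance) P :=
    indep_iSup_of_disjoint (fun i => (hZm i).comap_le) hZi (by simp)
  rw [iSup_singleton] at hind
  rw [IndepFun_iff_Indep]
  refine indep_of_indep_of_le_left hind (Measurable.comap_le ?_)
  refine Measurable.prodMk (Finset.measurable_sum _ fun j hj => Measurable.const_smul
    ((hm j).mono (biSup_mono fun i (hi : i ≤ j) => ?_) le_rfl) _) (hm s)
  exact hi.trans (Finset.mem_range.1 hj).le

variable [CompleteSpace H] [IsProbabilityMeasure P]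

/-- The vector inside the norm is the centered Doob martingale: the conditional mean of the full
weighted sum given the chain up to time `s`, minus its mean. Each step multiplies the expectation of
cosh by at most exp(θ²c²/2). -/
theorem lintegral_cosh_partialSum_le (hstep : ∀ s, Measurable fun p : H × 𝒵 => step s p.1 p.2)
    (hZm : ∀ t, Measurable (Z t)) (hZlaw : ∀ t, P.map (Z t) = μ) (hZi : iIndepFun Z P)
    (hS0 : ∀ ω, S 0 ω = g₁) (hS : ∀ s ω, S (s + 1) ω = step s (S s ω) (Z (s + 1) ω))
    {T : ℕ} {c : ℕ → ℝ} (hc : ∀ r s, s + r + 1 = T → ∀ g z z',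
      ‖futureMean μ step w r (s + 1) (step s g z)
        - futureMean μ step w r (s + 1) (step s g z')‖ ≤ c s)
    {θ : ℝ} (hθ : 0 ≤ θ) (s r : ℕ) (hsr : s + r = T) :
    ∫⁻ ω, ENNReal.ofReal (Real.cosh (θ * ‖∑ j ∈ Finset.range s, w j • S j ω
        + futureMean μ step w r s (S s ω) - futureMean μ step w T 0 g₁‖)) ∂P
      ≤ ENNReal.ofReal (Real.exp (θ ^ 2 / 2 * ∑ j ∈ Finset.range s, c j ^ 2)) := by
  induction s generalizing r with
  | zero =>
    obtain rfl : r = T := by omega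
    simp [hS0]
  | succ s ih =>
    set V := futureMean μ step w T 0 g₁
    have hF := fun r s => measurable_futureMean (w := w) (μ := μ) hstep r s
    set f : H → 𝒵 → H := fun g z => futureMean μ step w r (s + 1) (step s g z) with hf
    have hfm : Measurable fun p : H × 𝒵 => f p.1 p.2 := (hF r (s + 1)).comp (hstep s)
    have hfz : ∀ g, Measurable (f g) := fun g => hfm.comp measurable_prodMk_left
    have hfc : ∀ g z z', ‖f g z - f g z'‖ ≤ c s := hc r s (by omega)
    have hfi : ∀ g, Integrable (f g) μ := fun g => integrable_of_dist_le (hfz g) (hfc g)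
    -- The martingale increment. It is an average of differences over two samples, so it inherits
    -- the bound `c s`.
    set D : H → 𝒵 → H := fun g z => f g z - ∫ z', f g z' ∂μ with hD
    have hDm : Measurable fun p : H × 𝒵 => D p.1 p.2 :=
      hfm.sub (hfm.stronglyMeasurable.integral_prod_right.measurable.comp measurable_fst)
    have hDi : ∀ g, Integrable (D g) μ := fun g => (hfi g).sub (integrable_const _)
    have hD0 : ∀ g, ∫ z, D g z ∂μ = 0 := fun g => by
      rw [hD, integral_sub (hfi g) (integrable_const _)]; simp
    have hDc : ∀ g z, ‖D g z‖ ≤ c s := fun g z => by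
      have h1 : D g z = ∫ z', (f g z - f g z') ∂μ := by
        rw [integral_sub (integrable_const _) (hfi g)]; simp [hD]
      rw [h1]
      simpa using norm_integral_le_of_norm_le_const (ae_of_all μ fun z' => hfc g z z')
    set A : Ω → H × H := fun ω => (∑ j ∈ Finset.range s, w j • S j ω, S s ω) with hA
    set B : H × H → H := fun p => p.1 + futureMean μ step w (r + 1) s p.2 - V with hB
    have hBm : Measurable B := by
      have := (hF (r + 1) s).comp (measurable_snd : Measurable (Prod.snd : H × H → H))
      exact (measurable_fst.add this).sub_const V
    have hSm : ∀ j, Measurable (S j) := fun j =>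
      (measurable_iterate_iSup_comap hstep hS0 hS j).mono
        (iSup₂_le fun i _ => (hZm i).comap_le) le_rfl
    have hAm : Measurable A :=
      (Finset.measurable_sum _ fun j _ => (hSm j).const_smul _).prodMk (hSm s)
    set Φ : (H × H) × 𝒵 → ENNReal := fun q =>
      ENNReal.ofReal (Real.cosh (θ * ‖B q.1 + D q.1.2 q.2‖)) with hΦ
    have hΦm : Measurable Φ := by
      have h1 : Measurable fun q : (H × H) × 𝒵 => D q.1.2 q.2 :=
        hDm.comp ((measurable_snd.comp measurable_fst).prodMk measurable_snd)
      exact ENNReal.measurable_ofReal.comp (Real.continuous_cosh.measurable.comp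
        (((hBm.comp measurable_fst).add h1).norm.const_mul θ))
    -- Independence turns the joint law into a product, so the fresh sample can be integrated out
    -- first by Fubini with the past frozen.
    have hlaw : P.map (fun ω => (A ω, Z (s + 1) ω)) = (P.map A).prod μ := by
      rw [← hZlaw (s + 1)]
      exact (indepFun_iff_map_prod_eq_prod_map_map hAm.aemeasurable (hZm _).aemeasurable).1
        (indepFun_partialSum_iterate hstep hZm hZi hS0 hS s)
    have hinner : ∀ p, ∫⁻ z, Φ (p, z) ∂μ
        ≤ ENNReal.ofReal (Real.cosh (θ * ‖B p‖)) * ENNReal.ofReal (Real.exp (θ ^ 2 * c s ^ 2 / 2)) := by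
      intro p
      obtain ⟨hi, hle⟩ := integral_cosh_norm_add_le μ (θ • B p) (D := fun z => θ • D p.2 z)
        ((hDi p.2).smul θ) (by rw [integral_smul, hD0, smul_zero]) (c := θ * c s)
        (fun z => by rw [norm_smul, Real.norm_of_nonneg hθ]; gcongr; exact hDc _ _)
      simp_rw [← smul_add, norm_smul, Real.norm_of_nonneg hθ] at hi hle
      rw [← ENNReal.ofReal_mul (Real.cosh_pos _).le, ← ofReal_integral_eq_lintegral_ofReal hi
        (ae_of_all _ fun z => (Real.cosh_pos _).le)]
      refine ENNReal.ofReal_le_ofReal (hle.trans_eq ?_)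
      rw [mul_pow]
    calc ∫⁻ ω, ENNReal.ofReal (Real.cosh (θ * ‖∑ j ∈ Finset.range (s + 1), w j • S j ω
            + futureMean μ step w r (s + 1) (S (s + 1) ω) - V‖)) ∂P
        = ∫⁻ ω, Φ (A ω, Z (s + 1) ω) ∂P := by
          refine lintegral_congr fun ω => ?_
          simp only [hΦ, hB, hD, hA, hf, futureMean_succ, Finset.sum_range_succ, hS s ω]
          congr 4
          abel
      _ = ∫⁻ p, ∫⁻ z, Φ (p, z) ∂μ ∂(P.map A) := by
          rw [← lintegral_map (g := fun ω => (A ω, Z (s + 1) ω)) hΦm (hAm.prodMk (hZm _)), hlaw,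
            lintegral_prod _ hΦm.aemeasurable]
      _ ≤ ∫⁻ p, ENNReal.ofReal (Real.cosh (θ * ‖B p‖))
            * ENNReal.ofReal (Real.exp (θ ^ 2 * c s ^ 2 / 2)) ∂(P.map A) := lintegral_mono hinner
      _ = (∫⁻ ω, ENNReal.ofReal (Real.cosh (θ * ‖B (A ω)‖)) ∂P)
            * ENNReal.ofReal (Real.exp (θ ^ 2 * c s ^ 2 / 2)) := by
          have h1 : Measurable fun p => ENNReal.ofReal (Real.cosh (θ * ‖B p‖)) :=
            ENNReal.measurable_ofReal.comp (Real.continuous_cosh.measurable.comp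
              (hBm.norm.const_mul θ))
          rw [lintegral_mul_const _ h1, lintegral_map h1 hAm]
      _ ≤ ENNReal.ofReal (Real.exp (θ ^ 2 / 2 * ∑ j ∈ Finset.range s, c j ^ 2))
            * ENNReal.ofReal (Real.exp (θ ^ 2 * c s ^ 2 / 2)) := by
          gcongr
          exact ih (r + 1) (by omega)
      _ = _ := by
          rw [← ENNReal.ofReal_mul (Real.exp_pos _).le, ← Real.exp_add, Finset.sum_range_succ]
          congr 2
          ring

/-- Markov's inequality for cosh(θ‖·‖) at θ = ε/C, the minimizer of θ²C/2 - θε. The factor 2 comes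
from cosh u ≥ exp(u)/2. -/
theorem measureReal_norm_weightedSum_sub_ge_le
    (hstep : ∀ s, Measurable fun p : H × 𝒵 => step s p.1 p.2)
    (hZm : ∀ t, Measurable (Z t)) (hZlaw : ∀ t, P.map (Z t) = μ) (hZi : iIndepFun Z P)
    (hS0 : ∀ ω, S 0 ω = g₁) (hS : ∀ s ω, S (s + 1) ω = step s (S s ω) (Z (s + 1) ω))
    {T : ℕ} {c : ℕ → ℝ} (hc : ∀ r s, s + r + 1 = T → ∀ g z z',
      ‖futureMean μ step w r (s + 1) (step s g z)
        - futureMean μ step w r (s + 1) (step s g z')‖ ≤ c s)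
    {C : ℝ} (hC : 0 < C) (hcC : ∑ j ∈ Finset.range T, c j ^ 2 ≤ C) {ε : ℝ} (hε : 0 ≤ ε) :
    P.real {ω | ε ≤ ‖∑ j ∈ Finset.range (T + 1), w j • S j ω - futureMean μ step w T 0 g₁‖}
      ≤ 2 * Real.exp (-(ε ^ 2 / (2 * C))) := by
  set θ := ε / C with hθ
  have hθ0 : 0 ≤ θ := by positivity
  have h := lintegral_cosh_partialSum_le (w := w) hstep hZm hZlaw hZi hS0 hS hc hθ0 T 0 (by simp)
  simp only [futureMean_zero, ← Finset.sum_range_succ (fun j => w j • S j _)] at h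
  set Y : Ω → ℝ := fun ω => ‖∑ j ∈ Finset.range (T + 1), w j • S j ω - futureMean μ step w T 0 g₁‖
    with hY
  have hSm : ∀ j, Measurable (S j) := fun j =>
    (measurable_iterate_iSup_comap hstep hS0 hS j).mono
      (iSup₂_le fun i _ => (hZm i).comap_le) le_rfl
  have hYm : Measurable Y :=
    ((Finset.measurable_sum _ fun j _ => (hSm j).const_smul _).sub_const _).norm
  have hm : Measurable fun ω => ENNReal.ofReal (Real.cosh (θ * Y ω)) :=
    ENNReal.measurable_ofReal.comp (Real.continuous_cosh.measurable.comp (hYm.const_mul θ))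
  have h1 := mul_meas_ge_le_lintegral₀ (μ := P) hm.aemeasurable (ENNReal.ofReal (Real.cosh (θ * ε)))
  have h2 : P {ω | ε ≤ Y ω}
      ≤ P {ω | ENNReal.ofReal (Real.cosh (θ * ε)) ≤ ENNReal.ofReal (Real.cosh (θ * Y ω))} := by
    refine measure_mono fun ω (hω : ε ≤ Y ω) => ENNReal.ofReal_le_ofReal ?_
    rw [Real.cosh_le_cosh, abs_of_nonneg (by positivity), abs_of_nonneg (by positivity)]
    gcongr
  have h3 : ENNReal.ofReal (Real.cosh (θ * ε)) * P {ω | ε ≤ Y ω}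
      ≤ ENNReal.ofReal (Real.exp (θ ^ 2 / 2 * C)) :=
    (mul_le_mul_right h2 _).trans (h1.trans (h.trans (ENNReal.ofReal_le_ofReal
      (Real.exp_le_exp.2 (by gcongr)))))
  have h4 : Real.cosh (θ * ε) * P.real {ω | ε ≤ Y ω} ≤ Real.exp (θ ^ 2 / 2 * C) := by
    have := ENNReal.toReal_mono ENNReal.ofReal_ne_top h3
    rwa [ENNReal.toReal_mul, ENNReal.toReal_ofReal (Real.cosh_pos _).le,
      ENNReal.toReal_ofReal (Real.exp_pos _).le] at this
  have h5 : Real.exp (θ * ε) / 2 ≤ Real.cosh (θ * ε) := by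
    rw [Real.cosh_eq]
    linarith [Real.exp_pos (-(θ * ε))]
  have h6 : Real.exp (θ * ε) / 2 * P.real {ω | ε ≤ Y ω} ≤ Real.exp (θ ^ 2 / 2 * C) :=
    (mul_le_mul_of_nonneg_right h5 measureReal_nonneg).trans h4
  have h7 : Real.exp (θ ^ 2 / 2 * C) = Real.exp (θ * ε) * Real.exp (-(ε ^ 2 / (2 * C))) := by
    rw [← Real.exp_add]
    congr 1
    rw [hθ]
    field_simp
    ring
  rw [h7] at h6
  have := Real.exp_pos (θ * ε)
  nlinarith

end MarkovAverage

/-! ### Minimizers of strongly convex functionals. -/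

section Minimizers

variable {H : Type*} [NormedAddCommGroup H] [InnerProductSpace ℝ H]

/-- Midpoints of a minimizing sequence cannot go below the infimum, so the quadratic gain forces the
sequence to be Cauchy. -/
theorem exists_isMinOn_of_strongly_midpoint_convex [CompleteSpace H] {F : H → ℝ}
    (hF : Continuous F) (hF0 : ∀ g, 0 ≤ F g) {c : ℝ} (hc : 0 < c)
    (hmid : ∀ f g, F ((1 / 2 : ℝ) • f + (1 / 2 : ℝ) • g)
      ≤ 1 / 2 * F f + 1 / 2 * F g - c * ‖f - g‖ ^ 2) :
    ∃ g, IsMinOn F Set.univ g := by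
  set I := ⨅ g, F g with hI
  have hbdd : BddBelow (Set.range F) := ⟨0, by rintro _ ⟨g, rfl⟩; exact hF0 g⟩
  have hle : ∀ g, I ≤ F g := ciInf_le hbdd
  have hlt : ∀ n : ℕ, ∃ g, F g < I + 1 / ((n : ℝ) + 1) := fun n =>
    exists_lt_of_ciInf_lt (lt_add_of_pos_right I (by positivity))
  choose G hG using hlt
  have hdist : ∀ n m : ℕ, n ≤ m → c * ‖G n - G m‖ ^ 2 ≤ 1 / ((n : ℝ) + 1) := by
    intro n m hnm
    have h1 := hmid (G n) (G m)
    have h2 := hle ((1 / 2 : ℝ) • G n + (1 / 2 : ℝ) • G m)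
    have h3 := hG n
    have h4 := hG m
    have h5 : 1 / ((m : ℝ) + 1) ≤ 1 / ((n : ℝ) + 1) := by gcongr
    linarith
  have hcau : CauchySeq G := by
    rw [Metric.cauchySeq_iff']
    intro ε hε
    obtain ⟨N, hN⟩ := exists_nat_one_div_lt (show (0 : ℝ) < c * ε ^ 2 by positivity)
    refine ⟨N, fun n hn => ?_⟩
    rw [dist_comm, dist_eq_norm]
    refine lt_of_pow_lt_pow_left₀ 2 hε.le (lt_of_mul_lt_mul_left ?_ hc.le)
    exact (hdist N n hn).trans_lt hN
  obtain ⟨g, hg⟩ := cauchySeq_tendsto_of_complete hcau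
  have hlim : F g ≤ I := by
    have h1 : Filter.Tendsto (fun n : ℕ => I + 1 / ((n : ℝ) + 1)) Filter.atTop (nhds (I + 0)) :=
      tendsto_const_nhds.add tendsto_one_div_add_atTop_nhds_zero_nat
    rw [add_zero] at h1
    exact le_of_tendsto_of_tendsto' ((hF.tendsto g).comp hg) h1 fun n => (hG n).le
  exact ⟨g, fun x _ => hlim.trans (hle x)⟩

/-- Compare `f` with the point a fraction t of the way to `g`, divide by t and let t → 0. No
differentiability is required. -/
theorem IsMinOn.add_sq_le_of_strongly_convex {F : H → ℝ} {c : ℝ}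
    (hF : ∀ f g, ∀ a b : ℝ, 0 ≤ a → 0 ≤ b → a + b = 1 →
      F (a • f + b • g) ≤ a * F f + b * F g - c * (a * b) * ‖f - g‖ ^ 2)
    {f : H} (hf : IsMinOn F Set.univ f) (g : H) : F f + c * ‖f - g‖ ^ 2 ≤ F g := by
  have h : ∀ t ∈ Set.Ioo (0 : ℝ) 1, F f + c * (1 - t) * ‖f - g‖ ^ 2 ≤ F g := by
    rintro t ⟨h0, h1⟩
    have h2 := hF f g (1 - t) t (by linarith) h0.le (by ring)
    have h3 : F f ≤ F ((1 - t) • f + t • g) := hf (Set.mem_univ _)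
    have h4 : t * (F f + c * (1 - t) * ‖f - g‖ ^ 2) ≤ t * F g := by nlinarith
    exact le_of_mul_le_mul_left h4 h0
  have hlim : Filter.Tendsto (fun t : ℝ => F f + c * (1 - t) * ‖f - g‖ ^ 2)
      (nhdsWithin 0 (Set.Ioi 0)) (nhds (F f + c * (1 - 0) * ‖f - g‖ ^ 2)) :=
    (Continuous.tendsto (by fun_prop) 0).mono_left nhdsWithin_le_nhds
  rw [sub_zero, mul_one] at hlim
  exact le_of_tendsto hlim (Filter.eventually_of_mem (Ioo_mem_nhdsGT one_pos) h)

end Minimizers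

/-! ### Kernel spaces and the regularized risk. -/

section KernelSpace

variable {X H : Type*} [NormedAddCommGroup H] [InnerProductSpace ℝ H] [RKHS ℝ H X ℝ]
  [CompleteSpace H]

theorem RKHS.apply_eq_inner (f : H) (x : X) : f x = ⟪f, RKHS.kerFun H x 1⟫_ℝ := by
  simp

theorem RKHS.abs_apply_le (hk : ∀ x : X, ‖RKHS.kerFun H x 1‖ ≤ 1) (f : H) (x : X) :
    |f x| ≤ ‖f‖ := by
  rw [RKHS.apply_eq_inner]
  exact (abs_real_inner_le_norm _ _).trans (mul_le_of_le_one_right (norm_nonneg _) (hk x))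

/-- The kernel sections are the continuous image of a separable space and their span is dense.
Second countability makes the Borel structure on H compatible with products, which the measurability
of the iterates relies on. -/
theorem RKHS.secondCountableTopology [TopologicalSpace X] [TopologicalSpace.SeparableSpace X]
    (hc : Continuous fun x : X => RKHS.kerFun H x 1) : SecondCountableTopology H := by
  have h1 : TopologicalSpace.IsSeparable (Set.range fun x : X => RKHS.kerFun H x 1) :=
    TopologicalSpace.isSeparable_range hc
  have h2 := (TopologicalSpace.IsSeparable.span (R := ℝ) h1).closure
  have h3 : Submodule.span ℝ {RKHS.kerFun H x v | (x : X) (v : ℝ)}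
      ≤ Submodule.span ℝ (Set.range fun x : X => RKHS.kerFun H x 1) := by
    refine Submodule.span_le.2 ?_
    rintro _ ⟨x, v, rfl⟩
    have : RKHS.kerFun H x v = v • RKHS.kerFun H x 1 := by
      rw [← map_smul, smul_eq_mul, mul_one]
    rw [this]
    exact Submodule.smul_mem _ _ (Submodule.subset_span ⟨x, rfl⟩)
  have h4 : closure (Submodule.span ℝ (Set.range fun x : X => RKHS.kerFun H x 1) : Set H)
      = Set.univ := by
    refine Set.eq_univ_of_univ_subset ?_
    have h5 := congrArg (fun S : Submodule ℝ H => (S : Set H)) (RKHS.kerFun_dense (𝕜 := ℝ) (X := X) (V := ℝ) H)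
    simp only [Submodule.topologicalClosure_coe, Submodule.top_coe] at h5
    rw [← h5]
    exact closure_mono h3
  rw [h4] at h2
  have := TopologicalSpace.isSeparable_univ_iff.1 h2
  exact UniformSpace.secondCountable_of_separable H

theorem RKHS.continuous_coe [TopologicalSpace X]
    (hc : Continuous fun x : X => RKHS.kerFun H x 1) (f : H) : Continuous (f : X → ℝ) := by
  rw [show (f : X → ℝ) = fun x => ⟪f, RKHS.kerFun H x 1⟫_ℝ from funext fun x =>
    RKHS.apply_eq_inner f x]
  fun_prop

theorem RKHS.measurable_uncurry_coe [TopologicalSpace X] [SecondCountableTopology X]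
    [MeasurableSpace X] [OpensMeasurableSpace X] [MeasurableSpace H] [BorelSpace H]
    [SecondCountableTopology H] (hc : Continuous fun x : X => RKHS.kerFun H x 1) :
    Measurable fun p : H × X => p.1 p.2 := by
  simp_rw [RKHS.apply_eq_inner]
  have : Continuous fun p : H × X => ⟪p.1, RKHS.kerFun H p.2 1⟫_ℝ := by fun_prop
  exact this.measurable

theorem RKHS.inner_kerFun_one (x y : X) :
    ⟪RKHS.kerFun H x 1, RKHS.kerFun H y 1⟫_ℝ = RKHS.kernel H x y 1 := by
  rw [← RKHS.kerFun_apply, RKHS.apply_eq_inner, real_inner_comm]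

theorem RKHS.norm_kerFun_eq_one_of_gaussian {E : Type*} [NormedAddCommGroup E] {ι : X → E} {s : ℝ}
    (hker : ∀ x x' : X, RKHS.kernel H x x' 1 = gaussianKernel s (ι x) (ι x')) (x : X) :
    ‖RKHS.kerFun H x 1‖ = 1 := by
  have h : ‖RKHS.kerFun H x 1‖ ^ 2 = 1 := by
    rw [← real_inner_self_eq_norm_sq, RKHS.inner_kerFun_one, hker]
    simp [gaussianKernel]
  exact (pow_eq_one_iff_of_nonneg (norm_nonneg _) two_ne_zero).1 h

theorem RKHS.continuous_kerFun_of_gaussian [TopologicalSpace X] {E : Type*} [NormedAddCommGroup E]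
    {ι : X → E} (hι : Continuous ι) {s : ℝ}
    (hker : ∀ x x' : X, RKHS.kernel H x x' 1 = gaussianKernel s (ι x) (ι x')) :
    Continuous fun x : X => RKHS.kerFun H x 1 := by
  have key : ∀ x y : X, ‖RKHS.kerFun H x 1 - RKHS.kerFun H y 1‖
      = √(2 - 2 * gaussianKernel s (ι x) (ι y)) := fun x y => by
    rw [← Real.sqrt_sq (norm_nonneg (RKHS.kerFun H x 1 - RKHS.kerFun H y 1)), norm_sub_sq_real,
      RKHS.inner_kerFun_one, hker, RKHS.norm_kerFun_eq_one_of_gaussian hker,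
      RKHS.norm_kerFun_eq_one_of_gaussian hker]
    congr 1
    ring
  refine continuous_iff_continuousAt.2 fun y => tendsto_iff_norm_sub_tendsto_zero.2 ?_
  simp_rw [key]
  have hcont : Continuous fun x => √(2 - 2 * gaussianKernel s (ι x) (ι y)) := by
    unfold gaussianKernel
    fun_prop
  convert hcont.tendsto y using 2
  simp [gaussianKernel]

section Risk

variable [TopologicalSpace X] [MeasurableSpace X]
  [OpensMeasurableSpace X] {ρ : Measure (X × Label)}

omit [TopologicalSpace X] [OpensMeasurableSpace X] in
theorem measurable_logisticLoss_comp {f : X → ℝ} (hf : Measurable f) :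
    Measurable fun z : X × Label => logisticLoss (f z.1) z.2 :=
  continuous_logisticLoss.measurable.comp
    ((hf.comp measurable_fst).prodMk (measurable_subtype_coe.comp measurable_snd))

omit [TopologicalSpace X] [OpensMeasurableSpace X] in
theorem integrable_logisticLoss_of_bounded [IsFiniteMeasure ρ] {f : X → ℝ} (hf : Measurable f)
    {B : ℝ} (hB : ∀ x, |f x| ≤ B) :
    Integrable (fun z : X × Label => logisticLoss (f z.1) z.2) ρ := by
  refine Integrable.of_bound (measurable_logisticLoss_comp hf).aestronglyMeasurable
    (logistic 0 + B) (ae_of_all _ fun z => ?_)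
  have h1 := abs_logisticLoss_sub_le (f z.1) 0 z.2
  rw [sub_zero] at h1
  have h2 : logisticLoss 0 (z.2 : ℝ) = logistic 0 := by simp [logisticLoss]
  rw [Real.norm_of_nonneg (logisticLoss_nonneg _ _)]
  linarith [hB z.1, le_abs_self (logisticLoss (f z.1) z.2 - logisticLoss 0 z.2)]

variable [IsProbabilityMeasure ρ] (hc : Continuous fun x : X => RKHS.kerFun H x 1)
  (hk : ∀ x : X, ‖RKHS.kerFun H x 1‖ ≤ 1)
include hc hk

theorem RKHS.integrable_logisticLoss (f : H) :
    Integrable (fun z : X × Label => logisticLoss (f z.1) z.2) ρ :=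
  integrable_logisticLoss_of_bounded (RKHS.continuous_coe hc f).measurable (RKHS.abs_apply_le hk f)

theorem abs_risk_sub_le (f g : H) : |risk ρ (f : X → ℝ) - risk ρ (g : X → ℝ)| ≤ ‖f - g‖ := by
  unfold risk
  rw [← integral_sub (RKHS.integrable_logisticLoss hc hk f)
    (RKHS.integrable_logisticLoss hc hk g), ← Real.norm_eq_abs]
  have h := norm_integral_le_of_norm_le_const (μ := ρ) (C := ‖f - g‖)
    (f := fun z => logisticLoss (f z.1) z.2 - logisticLoss (g z.1) z.2) (ae_of_all _ fun z => ?_)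
  · simpa using h
  refine (abs_logisticLoss_sub_le _ _ _).trans ?_
  simpa using RKHS.abs_apply_le hk (f - g) z.1

theorem continuous_risk : Continuous fun f : H => risk ρ (f : X → ℝ) :=
  (LipschitzWith.of_dist_le_mul (K := 1) fun f g => by
    rw [Real.dist_eq, dist_eq_norm, NNReal.coe_one, one_mul]
    exact abs_risk_sub_le hc hk f g).continuous

theorem regRisk_strongly_convex (lam : ℝ) (f g : H) (a b : ℝ) (ha : 0 ≤ a) (hb : 0 ≤ b)
    (hab : a + b = 1) :
    regRisk ρ lam (a • f + b • g)
      ≤ a * regRisk ρ lam f + b * regRisk ρ lam g - lam / 2 * (a * b) * ‖f - g‖ ^ 2 := by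
  have h1 : risk ρ ((a • f + b • g : H) : X → ℝ)
      ≤ a * risk ρ (f : X → ℝ) + b * risk ρ (g : X → ℝ) := by
    have hf := RKHS.integrable_logisticLoss (ρ := ρ) hc hk f
    have hg := RKHS.integrable_logisticLoss (ρ := ρ) hc hk g
    unfold risk
    rw [← integral_const_mul, ← integral_const_mul,
      ← integral_add (hf.const_mul a) (hg.const_mul b)]
    refine integral_mono (RKHS.integrable_logisticLoss hc hk _)
      ((hf.const_mul a).add (hg.const_mul b)) fun z => ?_
    simpa using logisticLoss_convex (f z.1) (g z.1) z.2 ha hb hab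
  have h2 : ‖a • f + b • g‖ ^ 2 = a * ‖f‖ ^ 2 + b * ‖g‖ ^ 2 - a * b * ‖f - g‖ ^ 2 := by
    rw [norm_add_sq_real, norm_sub_sq_real, norm_smul, norm_smul, mul_pow, mul_pow,
      Real.norm_eq_abs, Real.norm_eq_abs, sq_abs, sq_abs, real_inner_smul_left,
      real_inner_smul_right]
    obtain rfl : b = 1 - a := by linarith
    ring
  unfold regRisk
  rw [h2]
  linarith

theorem regRisk_isMinOn_add_sq_le {lam : ℝ} {gmin : H}
    (hmin : IsMinOn (regRisk ρ lam) Set.univ gmin) (g : H) :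
    regRisk ρ lam gmin + lam / 2 * ‖gmin - g‖ ^ 2 ≤ regRisk ρ lam g :=
  hmin.add_sq_le_of_strongly_convex (regRisk_strongly_convex hc hk lam) g

theorem existsUnique_isMinOn_regRisk {lam : ℝ} (hlam : 0 < lam) :
    ∃! gmin : H, IsMinOn (regRisk ρ lam) Set.univ gmin := by
  have hex : ∃ gmin : H, IsMinOn (regRisk ρ lam) Set.univ gmin := by
    refine exists_isMinOn_of_strongly_midpoint_convex (c := lam / 8) ?_ (fun g => ?_)
      (by positivity) fun f g => ?_
    · have := continuous_risk (ρ := ρ) hc hk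
      unfold regRisk
      fun_prop
    · have : 0 ≤ risk ρ (g : X → ℝ) := integral_nonneg fun z => logisticLoss_nonneg _ _
      unfold regRisk
      positivity
    · refine (regRisk_strongly_convex hc hk lam f g (1 / 2) (1 / 2) (by norm_num) (by norm_num)
        (by norm_num)).trans_eq ?_
      ring
  obtain ⟨gmin, hg⟩ := hex
  refine ⟨gmin, hg, fun g hmin => ?_⟩
  have h1 := regRisk_isMinOn_add_sq_le hc hk hg g
  have h2 : regRisk ρ lam g ≤ regRisk ρ lam gmin := hmin (Set.mem_univ _)
  have h3 : lam / 2 * ‖gmin - g‖ ^ 2 ≤ lam / 2 * 0 := by linarith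
  have h4 : ‖gmin - g‖ ^ 2 ≤ 0 := le_of_mul_le_mul_left h3 (by positivity)
  have h5 : ‖gmin - g‖ = 0 := pow_eq_zero_iff two_ne_zero |>.1 (le_antisymm h4 (sq_nonneg _))
  exact (sub_eq_zero.1 (norm_eq_zero.1 h5)).symm

/-- The minimizers of the regularized risk converge to a Bayes rule as the regularization
vanishes, provided that some element of the hypothesis space is one. -/
theorem exists_isBayesRule_forall_isMinOn_dist_le {gstar : H}
    (hstar : IsBayesRule ρ (gstar : X → ℝ)) :
    ∃ g₀ : H, IsBayesRule ρ (g₀ : X → ℝ) ∧ ∀ ε : ℝ, 0 < ε → ∃ lam₀ : ℝ, 0 < lam₀ ∧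
      ∀ lam : ℝ, 0 < lam → lam ≤ lam₀ → ∀ gmin : H, IsMinOn (regRisk ρ lam) Set.univ gmin →
        ‖gmin - g₀‖ ≤ ε := by
  have hex := fun lam : {l : ℝ // 0 < l} =>
    existsUnique_isMinOn_regRisk (H := H) (ρ := ρ) hc hk lam.2
  choose! G hG hGu using fun (lam : ℝ) (h : 0 < lam) => hex ⟨lam, h⟩
  have hGmin : ∀ lam : ℝ, 0 < lam → IsMinOn (regRisk ρ lam) Set.univ (G lam) := hG
  have hmeas := fun f : H => (RKHS.continuous_coe hc f).measurable
  have hstar_le : ∀ f : H, risk ρ (gstar : X → ℝ) ≤ risk ρ (f : X → ℝ) := fun f =>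
    hstar.2.2 f (hmeas f) (RKHS.integrable_logisticLoss hc hk f)
  have hbdd : ∀ lam, 0 < lam → ‖G lam‖ ^ 2 ≤ ‖gstar‖ ^ 2 := fun lam h => by
    have h1 : regRisk ρ lam (G lam) ≤ regRisk ρ lam gstar := hGmin lam h (Set.mem_univ _)
    have h2 := hstar_le (G lam)
    unfold regRisk at h1
    have h3 : lam / 2 * ‖G lam‖ ^ 2 ≤ lam / 2 * ‖gstar‖ ^ 2 := by linarith
    exact le_of_mul_le_mul_left h3 (by positivity)
  -- Adding the two quadratic-growth inequalities cancels the risks and leaves (a + b)‖G a - G b‖² ≤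
  -- (b - a)(‖G a‖² - ‖G b‖²). So ‖G λ‖² increases as λ decreases; being bounded, it converges, and
  -- the same inequality then makes G Cauchy at 0.
  have hdist : ∀ a b, 0 < a → a ≤ b → ‖G a - G b‖ ^ 2 ≤ ‖G a‖ ^ 2 - ‖G b‖ ^ 2 := by
    intro a b ha hab
    have hb : 0 < b := ha.trans_le hab
    have h1 := regRisk_isMinOn_add_sq_le hc hk (hGmin a ha) (G b)
    have h2 := regRisk_isMinOn_add_sq_le hc hk (hGmin b hb) (G a)
    rw [norm_sub_rev] at h2
    unfold regRisk at h1 h2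
    have h3 : (a + b) * ‖G a - G b‖ ^ 2 ≤ (b - a) * (‖G a‖ ^ 2 - ‖G b‖ ^ 2) := by linarith
    have h0 := sq_nonneg ‖G a - G b‖
    rcases hab.eq_or_lt with rfl | hab'
    · simp
    · have h4 : 0 ≤ ‖G a‖ ^ 2 - ‖G b‖ ^ 2 := by
        by_contra! h
        nlinarith
      nlinarith
  set S := sSup ((fun lam => ‖G lam‖ ^ 2) '' Set.Ioi 0) with hS
  have hSb : BddAbove ((fun lam => ‖G lam‖ ^ 2) '' Set.Ioi 0) :=
    ⟨‖gstar‖ ^ 2, by rintro _ ⟨lam, h, rfl⟩; exact hbdd lam h⟩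
  have hcau : Cauchy (Filter.map G (nhdsWithin 0 (Set.Ioi 0))) := by
    rw [Metric.cauchy_iff]
    refine ⟨inferInstance, fun ε hε => ?_⟩
    obtain ⟨_, ⟨b, hb, rfl⟩, hlt⟩ := exists_lt_of_lt_csSup
      ((Set.nonempty_Ioi (a := (0 : ℝ))).image (fun lam => ‖G lam‖ ^ 2))
      (show S - (ε / 2) ^ 2 < S by linarith [show 0 < (ε / 2) ^ 2 by positivity])
    have hclose : ∀ a ∈ Set.Ioc 0 b, dist (G a) (G b) < ε / 2 := fun a ha => by
      rw [dist_eq_norm]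
      refine lt_of_pow_lt_pow_left₀ 2 (by positivity) ?_
      have h1 := hdist a b ha.1 ha.2
      have h2 : ‖G a‖ ^ 2 ≤ S := le_csSup hSb ⟨a, ha.1, rfl⟩
      simp only at hlt
      linarith
    refine ⟨G '' Set.Ioc 0 b, Filter.image_mem_map (Ioc_mem_nhdsGT hb), ?_⟩
    rintro _ ⟨a, ha, rfl⟩ _ ⟨a', ha', rfl⟩
    have h1 := hclose a ha
    have h2 := hclose a' ha'
    rw [dist_comm] at h2
    linarith [dist_triangle (G a) (G b) (G a')]
  obtain ⟨g₀, hg₀⟩ := CompleteSpace.complete hcau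
  have htend : Filter.Tendsto G (nhdsWithin 0 (Set.Ioi 0)) (nhds g₀) := hg₀
  refine ⟨g₀, ⟨hmeas g₀, RKHS.integrable_logisticLoss hc hk g₀, fun f' hf' hi => ?_⟩, fun ε hε => ?_⟩
  · refine le_trans ?_ (hstar.2.2 f' hf' hi)
    have h1 : Filter.Tendsto (fun lam : ℝ => risk ρ (gstar : X → ℝ) + lam / 2 * ‖gstar‖ ^ 2)
        (nhdsWithin 0 (Set.Ioi 0)) (nhds (risk ρ (gstar : X → ℝ) + 0 / 2 * ‖gstar‖ ^ 2)) :=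
      (Continuous.tendsto (by fun_prop) 0).mono_left nhdsWithin_le_nhds
    rw [zero_div, zero_mul, add_zero] at h1
    refine le_of_tendsto_of_tendsto (((continuous_risk hc hk).tendsto g₀).comp htend) h1 ?_
    filter_upwards [self_mem_nhdsWithin] with lam hlam
    have hlam' : 0 < lam := hlam
    have h2 : regRisk ρ lam (G lam) ≤ regRisk ρ lam gstar := hGmin lam hlam (Set.mem_univ _)
    unfold regRisk at h2
    have : 0 ≤ lam / 2 * ‖G lam‖ ^ 2 := by positivity
    simp only [Function.comp]
    linarith
  · have h1 := htend (Metric.closedBall_mem_nhds g₀ hε)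
    obtain ⟨lam₀, h0, h2⟩ := mem_nhdsGT_iff_exists_Ioc_subset.1 h1
    refine ⟨lam₀, h0, fun lam hl hle gmin hmin => ?_⟩
    rw [hGu lam hl gmin hmin, ← dist_eq_norm]
    exact h2 ⟨hl, hle⟩

end Risk

end KernelSpace

/-! ### Bayes rules, log-odds and the margin. -/

section BayesRule

theorem Real.sigmoid_log_odds {p : ℝ} (hp : p ∈ Set.Ioo (0 : ℝ) 1) :
    Real.sigmoid (Real.log (p / (1 - p))) = p := by
  have h0 := hp.1
  have h1 : 0 < 1 - p := by linarith [hp.2]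
  rw [Real.sigmoid_def, Real.exp_neg, Real.exp_log (by positivity)]
  field_simp
  ring

theorem logistic_eq_neg_log_sigmoid (v : ℝ) : logistic v = -Real.log (Real.sigmoid v) := by
  rw [Real.sigmoid_def, Real.log_inv, neg_neg, logistic]

/-- Gibbs' inequality for two Bernoulli laws. -/
theorem bernoulli_crossEntropy_lt {p q : ℝ} (hp : p ∈ Set.Ioo (0 : ℝ) 1)
    (hq : q ∈ Set.Ioo (0 : ℝ) 1) (hpq : q ≠ p) :
    p * -Real.log p + (1 - p) * -Real.log (1 - p)
      < p * -Real.log q + (1 - p) * -Real.log (1 - q) := by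
  obtain ⟨hp0, hp1⟩ := hp
  obtain ⟨hq0, hq1⟩ := hq
  have hp1' : 0 < 1 - p := by linarith
  have hq1' : 0 < 1 - q := by linarith
  have h1 : Real.log (q / p) < q / p - 1 := Real.log_lt_sub_one_of_pos (by positivity) (by
    rw [Ne, div_eq_one_iff_eq hp0.ne']; exact hpq)
  have h2 : Real.log ((1 - q) / (1 - p)) ≤ (1 - q) / (1 - p) - 1 :=
    Real.log_le_sub_one_of_pos (by positivity)
  rw [Real.log_div hq0.ne' hp0.ne'] at h1
  rw [Real.log_div hq1'.ne' hp1'.ne'] at h2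
  have h3 : p * (q / p - 1) = q - p := by field_simp
  have h4 : (1 - p) * ((1 - q) / (1 - p) - 1) = p - q := by field_simp; ring
  have h5 := mul_lt_mul_of_pos_left h1 hp0
  have h6 := mul_le_mul_of_nonneg_left h2 hp1'.le
  rw [h3] at h5
  rw [h4] at h6
  linarith

theorem condLogisticRisk_log_odds_lt {p : ℝ} (hp : p ∈ Set.Ioo (0 : ℝ) 1) {ζ : ℝ}
    (hζ : ζ ≠ Real.log (p / (1 - p))) :
    p * logisticLoss (Real.log (p / (1 - p))) 1 + (1 - p) * logisticLoss (Real.log (p / (1 - p))) (-1)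
      < p * logisticLoss ζ 1 + (1 - p) * logisticLoss ζ (-1) := by
  simp only [logisticLoss, one_mul, neg_one_mul, logistic_eq_neg_log_sigmoid, Real.sigmoid_neg,
    Real.sigmoid_log_odds hp]
  refine bernoulli_crossEntropy_lt hp ⟨Real.sigmoid_pos ζ, Real.sigmoid_lt_one ζ⟩ fun h => hζ ?_
  exact Real.sigmoid_injective (h.trans (Real.sigmoid_log_odds hp).symm)

variable {X : Type*} [MeasurableSpace X] {ρ : Measure (X × Label)} [IsFiniteMeasure ρ]

theorem integral_condKernel_label (φ : ℝ → ℝ) (x : X) :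
    ∫ y, φ (y : ℝ) ∂(ρ.condKernel x) = condProbOne ρ x * φ 1 + (1 - condProbOne ρ x) * φ (-1) := by
  have h : ∀ y : Label, φ (y : ℝ)
      = φ (-1) + (φ 1 - φ (-1)) * Set.indicator {posLabel} (fun _ => (1 : ℝ)) y := fun y => by
    rcases y.eq_one_or_neg_one with hy | hy
    · have : y = posLabel := Subtype.ext hy
      simp [this, posLabel]
    · have : y ≠ posLabel := fun h => by
        have h' : (y : ℝ) = 1 := by rw [h]; rfl
        rw [h'] at hy
        norm_num at hy
      rw [Set.indicator_of_notMem (by simpa using this), hy]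
      ring
  simp_rw [h]
  rw [integral_add (integrable_const _) (((integrable_const _).indicator
    (measurableSet_singleton _)).const_mul _), integral_const_mul, integral_indicator_const _
    (measurableSet_singleton _)]
  simp only [integral_const, probReal_univ, smul_eq_mul, one_mul, mul_one, condProbOne]
  ring

theorem condMean_eq (x : X) : condMean ρ x = 2 * condProbOne ρ x - 1 := by
  have := integral_condKernel_label (ρ := ρ) id x
  simp only [id] at this
  rw [condMean, this]
  ring

theorem measurable_condProbOne : Measurable (condProbOne ρ) :=
  (Kernel.measurable_coe ρ.condKernel (measurableSet_singleton posLabel)).ennreal_toReal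

/-- A bounded Bayes rule of the logistic risk is the log-odds of the conditional probability. -/
theorem IsBayesRule.ae_eq_log_odds {f : X → ℝ} (hf : IsBayesRule ρ f) {B : ℝ}
    (hB : ∀ x, |f x| ≤ B) (hcond : ∀ᵐ x ∂ρ.fst, condProbOne ρ x ∈ Set.Ioo (0 : ℝ) 1) :
    ∀ᵐ x ∂ρ.fst, f x = Real.log (condProbOne ρ x / (1 - condProbOne ρ x)) := by
  obtain ⟨hfm, hfi, hle⟩ := hf
  set h : X → ℝ := fun x => Real.log (condProbOne ρ x / (1 - condProbOne ρ x)) with hh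
  have hhm : Measurable h := Real.measurable_log.comp
    (measurable_condProbOne.div (measurable_const.sub measurable_condProbOne))
  have key : ∀ n : ℕ, ∀ᵐ x ∂ρ.fst, |h x| ≤ n → f x = h x := by
    intro n
    -- The log-odds may be unbounded, so its own risk need not be finite. Substituting it only where
    -- it is at most n gives a bounded, hence admissible, competitor.
    set f' : X → ℝ := fun x => if |h x| ≤ n then h x else f x with hf'
    have hf'm : Measurable f' :=
      Measurable.ite (measurableSet_le (continuous_abs.measurable.comp hhm) measurable_const) hhm hfm
    have hf'b : ∀ x, |f' x| ≤ max (n : ℝ) B := fun x => by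
      simp only [hf']
      split_ifs with h1
      · exact h1.trans (le_max_left _ _)
      · exact (hB x).trans (le_max_right _ _)
    have hf'i : Integrable (fun z : X × Label => logisticLoss (f' z.1) z.2) ρ :=
      integrable_logisticLoss_of_bounded hf'm hf'b
    have hrisk := hle f' hf'm hf'i
    unfold risk at hrisk
    rw [← Measure.integral_condKernel hfi, ← Measure.integral_condKernel hf'i] at hrisk
    have hi1 := hfi.integral_condKernel
    have hi2 := hf'i.integral_condKernel
    have hpt : ∀ᵐ x ∂ρ.fst, 0 ≤ (∫ y, logisticLoss (f x) y ∂(ρ.condKernel x))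
        - ∫ y, logisticLoss (f' x) y ∂(ρ.condKernel x) := by
      filter_upwards [hcond] with x hx
      rw [integral_condKernel_label (fun y => logisticLoss (f x) y),
        integral_condKernel_label (fun y => logisticLoss (f' x) y), sub_nonneg]
      simp only [hf']
      split_ifs with h1
      · rcases eq_or_ne (f x) (h x) with h2 | h2
        · rw [h2]
        · exact (condLogisticRisk_log_odds_lt hx h2).le
      · exact le_rfl
    -- The conditional risk of `f` minus that of `f'` is nonnegative, while optimality of `f` makes
    -- its integral nonpositive; so it vanishes almost everywhere, and strictness in Gibbs'
    -- inequality forces equality.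
    have hzero := (integral_eq_zero_iff_of_nonneg_ae hpt (hi1.sub hi2)).1 (le_antisymm (by
      rw [integral_sub hi1 hi2]; linarith) (integral_nonneg_of_ae hpt))
    filter_upwards [hcond, hzero] with x hx h0 h1
    by_contra h2
    have h3 := condLogisticRisk_log_odds_lt hx h2
    simp only [Pi.zero_apply] at h0
    rw [integral_condKernel_label (fun y => logisticLoss (f x) y),
        integral_condKernel_label (fun y => logisticLoss (f' x) y)] at h0
    simp only [hf', if_pos h1] at h0
    linarith
  filter_upwards [ae_all_iff.2 key] with x hx
  obtain ⟨n, hn⟩ := exists_nat_ge |h x|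
  exact hx n hn

/-- Under the strong low-noise condition a bounded Bayes rule is bounded away from zero and has
the sign of the conditional mean. -/
theorem IsBayesRule.ae_margin {f : X → ℝ} (hf : IsBayesRule ρ f) {B : ℝ}
    (hB : ∀ x, |f x| ≤ B) (hcond : ∀ᵐ x ∂ρ.fst, condProbOne ρ x ∈ Set.Ioo (0 : ℝ) 1)
    {δ : ℝ} (hδ : δ ∈ Set.Ioo (0 : ℝ) (1 / 2))
    (hnoise : ∀ᵐ x ∂ρ.fst, δ < |condProbOne ρ x - 1 / 2|) :
    ∀ᵐ x ∂ρ.fst, (Real.log ((1 + 2 * δ) / (1 - 2 * δ)) < f x ∧ 0 < condMean ρ x) ∨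
      (f x < -Real.log ((1 + 2 * δ) / (1 - 2 * δ)) ∧ condMean ρ x < 0) := by
  obtain ⟨hδ0, hδ1⟩ := hδ
  have h2δ : 0 < 1 - 2 * δ := by linarith
  filter_upwards [hf.ae_eq_log_odds hB hcond, hcond, hnoise] with x hfx hx hn
  obtain ⟨hx0, hx1⟩ := hx
  have hx1' : 0 < 1 - condProbOne ρ x := by linarith
  rw [hfx, condMean_eq]
  rcases lt_abs.1 hn with h | h
  · refine Or.inl ⟨Real.log_lt_log (by positivity) ?_, by linarith⟩
    rw [div_lt_div_iff₀ h2δ hx1']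
    nlinarith
  · refine Or.inr ⟨?_, by linarith⟩
    rw [← Real.log_inv, inv_div]
    refine Real.log_lt_log (by positivity) ?_
    rw [div_lt_div_iff₀ hx1' (by positivity)]
    nlinarith

omit [IsFiniteMeasure ρ] in
theorem classError_congr {f g : X → ℝ} (h : ∀ᵐ x ∂ρ.fst, Real.sign (f x) = Real.sign (g x)) :
    classError ρ f = classError ρ g := by
  refine measureReal_congr ?_
  have h' : ∀ᵐ z ∂ρ, Real.sign (f z.1) = Real.sign (g z.1) :=
    ae_of_ae_map measurable_fst.aemeasurable h
  filter_upwards [h'] with z hz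
  change (_ ≠ _) = (_ ≠ _)
  rw [hz]

theorem Real.measurable_sign : Measurable Real.sign :=
  Measurable.ite measurableSet_Iio measurable_const
    (Measurable.ite measurableSet_Ioi measurable_const measurable_const)

theorem measurable_classError_coe {H : Type*} [NormedAddCommGroup H] [InnerProductSpace ℝ H]
    [RKHS ℝ H X ℝ] [MeasurableSpace H] (hm : Measurable fun p : H × X => p.1 p.2) :
    Measurable fun g : H => classError ρ (g : X → ℝ) := by
  have h1 : MeasurableSet {q : H × (X × Label) | Real.sign (q.1 q.2.1) ≠ (q.2.2 : ℝ)} := by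
    refine (measurableSet_eq_fun ?_ ?_).compl
    · exact Real.measurable_sign.comp
        (hm.comp (measurable_fst.prodMk (measurable_fst.comp measurable_snd)))
    · exact measurable_subtype_coe.comp (measurable_snd.comp measurable_snd)
  exact (measurable_measure_prodMk_left h1).ennreal_toReal

end BayesRule

/-! ### One step of stochastic gradient descent. -/

section SGDStep

variable {X H : Type*} [NormedAddCommGroup H] [InnerProductSpace ℝ H] [RKHS ℝ H X ℝ]
  [CompleteSpace H]

/-- One step of stochastic gradient descent with learning rate `η`. -/
def sgdStep (lam η : ℝ) (g : H) (z : X × Label) : H := g - η • stochGrad lam g z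

theorem measurable_sgdStep [TopologicalSpace X] [MeasurableSpace X] [OpensMeasurableSpace X]
    [SecondCountableTopology X] [MeasurableSpace H] [BorelSpace H] [SecondCountableTopology H]
    (hc : Continuous fun x : X => RKHS.kerFun H x 1) (lam η : ℝ) :
    Measurable fun p : H × (X × Label) => sgdStep lam η p.1 p.2 := by
  have h1 : Measurable fun p : H × (X × Label) => logisticLossDeriv (p.1 p.2.1) p.2.2 :=
    continuous_logisticLossDeriv.measurable.comp (((RKHS.measurable_uncurry_coe hc).comp
      (measurable_fst.prodMk (measurable_fst.comp measurable_snd))).prodMk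
      (measurable_subtype_coe.comp (measurable_snd.comp measurable_snd)))
  have h2 : Measurable fun p : H × (X × Label) => RKHS.kerFun H p.2.1 1 :=
    hc.measurable.comp (measurable_fst.comp measurable_snd)
  exact measurable_fst.sub (((h1.smul h2).add (measurable_fst.const_smul lam)).const_smul η)

theorem sgdStep_eq (lam η : ℝ) (g : H) (z : X × Label) : sgdStep lam η g z
    = (1 - η * lam) • g - (η * logisticLossDeriv (g z.1) z.2) • RKHS.kerFun H z.1 1 := by
  rw [sgdStep, stochGrad, smul_add, smul_smul, smul_smul, sub_smul, one_smul]
  abel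

variable (hk : ∀ x : X, ‖RKHS.kerFun H x 1‖ ≤ 1)
include hk

theorem norm_logisticLossDeriv_smul_kerFun_le (ζ : ℝ) (z : X × Label) :
    ‖logisticLossDeriv ζ z.2 • RKHS.kerFun H z.1 1‖ ≤ 1 := by
  rw [norm_smul, Real.norm_eq_abs]
  exact mul_le_one₀ (abs_logisticLossDeriv_le _ _) (norm_nonneg _) (hk _)

theorem norm_sgdStep_le {lam η R : ℝ} (hη : 0 ≤ η) (hηl : η * lam ≤ 1) (hR : 1 ≤ lam * R)
    {g : H} (hg : ‖g‖ ≤ R) (z : X × Label) : ‖sgdStep lam η g z‖ ≤ R := by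
  have h1 := norm_logisticLossDeriv_smul_kerFun_le hk (g z.1) z
  rw [sgdStep_eq, mul_smul]
  calc _ ≤ (1 - η * lam) * ‖g‖ + η * 1 := by
        refine (norm_sub_le _ _).trans ?_
        rw [norm_smul, norm_smul, Real.norm_of_nonneg hη, Real.norm_of_nonneg (by linarith)]
        gcongr
    _ ≤ (1 - η * lam) * R + η * (lam * R) := by gcongr
    _ = R := by ring

theorem norm_stochGrad_le {lam : ℝ} (hlam : 0 ≤ lam) (g : H) (z : X × Label) :
    ‖stochGrad lam g z‖ ≤ 1 + lam * ‖g‖ := by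
  refine (norm_add_le _ _).trans (add_le_add (norm_logisticLossDeriv_smul_kerFun_le hk _ z) ?_)
  rw [norm_smul, Real.norm_of_nonneg hlam]

theorem norm_sgdStep_sub_sgdStep_sample_le (lam : ℝ) {η : ℝ} (hη : 0 ≤ η) (g : H)
    (z z' : X × Label) : ‖sgdStep lam η g z - sgdStep lam η g z'‖ ≤ 2 * η := by
  rw [sgdStep_eq, sgdStep_eq, sub_sub_sub_cancel_left, mul_smul, mul_smul, ← smul_sub, norm_smul,
    Real.norm_of_nonneg hη, mul_comm 2 η]
  gcongr
  refine (norm_sub_le _ _).trans ?_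
  linarith [norm_logisticLossDeriv_smul_kerFun_le hk (g z.1) z,
    norm_logisticLossDeriv_smul_kerFun_le hk (g z'.1) z']

/-- A substitute for contraction at large learning rates: it uses only that loss derivatives differ
by at most 1. -/
theorem norm_sgdStep_sub_sgdStep_le_add {lam η : ℝ} (hη : 0 ≤ η) (hηl : η * lam ≤ 1) (g g' : H)
    (z : X × Label) :
    ‖sgdStep lam η g z - sgdStep lam η g' z‖ ≤ (1 - η * lam) * ‖g - g'‖ + η := by
  have h : sgdStep lam η g z - sgdStep lam η g' z = (1 - η * lam) • (g - g')
      - (η * (logisticLossDeriv (g z.1) z.2 - logisticLossDeriv (g' z.1) z.2))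
        • RKHS.kerFun H z.1 1 := by
    rw [sgdStep_eq, sgdStep_eq, mul_sub, sub_smul _ _ (RKHS.kerFun H z.1 1), smul_sub]
    abel
  rw [h]
  refine (norm_sub_le _ _).trans ?_
  rw [norm_smul, norm_smul, Real.norm_of_nonneg (by linarith : 0 ≤ 1 - η * lam), norm_mul,
    Real.norm_of_nonneg hη, Real.norm_eq_abs, mul_assoc]
  have h1 := mul_le_one₀ (abs_logisticLossDeriv_sub_le (g z.1) (g' z.1) z.2)
    (norm_nonneg _) (hk z.1)
  nlinarith

/-- With p = (g - g')(x), the loss part adds -2(1 - ηλ)ηa p² + η²a²p²‖k‖² to the squared norm. This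
is nonpositive because ηa ≤ 1 ≤ 2(1 - ηλ). -/
theorem norm_sgdStep_sub_sgdStep_le {lam η : ℝ} (hη : 0 ≤ η) (hη1 : η ≤ 1)
    (hηl : η * lam ≤ 1 / 2) (g g' : H) (z : X × Label) :
    ‖sgdStep lam η g z - sgdStep lam η g' z‖ ≤ (1 - η * lam) * ‖g - g'‖ := by
  obtain ⟨a, ⟨ha0, ha1⟩, ha⟩ := exists_logisticLossDeriv_sub_eq (g z.1) (g' z.1) z.2
  have hp : g z.1 - g' z.1 = ⟪g - g', RKHS.kerFun H z.1 1⟫_ℝ := by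
    rw [← RKHS.apply_eq_inner, RKHS.coe_sub, Pi.sub_apply]
  set p := g z.1 - g' z.1
  have h : sgdStep lam η g z - sgdStep lam η g' z = (1 - η * lam) • (g - g')
      - (η * (a * p)) • RKHS.kerFun H z.1 1 := by
    rw [← ha, sgdStep_eq, sgdStep_eq, mul_sub, sub_smul _ _ (RKHS.kerFun H z.1 1), smul_sub]
    abel
  refine le_of_sq_le_sq ?_ (mul_nonneg (by linarith) (norm_nonneg _))
  have hk2 : ‖RKHS.kerFun H z.1 1‖ ^ 2 ≤ 1 := pow_le_one₀ (norm_nonneg _) (hk z.1)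
  rw [h, norm_sub_sq_real, norm_smul, norm_smul, mul_pow, mul_pow, Real.norm_eq_abs,
    Real.norm_eq_abs, sq_abs, sq_abs, real_inner_smul_left, real_inner_smul_right, ← hp, mul_pow]
  have h1 : (η * (a * p)) ^ 2 * ‖RKHS.kerFun H z.1 1‖ ^ 2 ≤ (η * (a * p)) ^ 2 :=
    mul_le_of_le_one_right (sq_nonneg _) hk2
  have hηa : η * a ≤ 1 := mul_le_one₀ hη1 ha0 ha1
  have h2 : 0 ≤ η * a * p ^ 2 * (2 * (1 - η * lam) - η * a) :=
    mul_nonneg (by positivity) (by linarith)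
  nlinarith

variable [TopologicalSpace X] [MeasurableSpace X] [OpensMeasurableSpace X]
  [SecondCountableTopology X] [MeasurableSpace H] [BorelSpace H] [SecondCountableTopology H]
  {ρ : Measure (X × Label)} [IsProbabilityMeasure ρ]
  (hc : Continuous fun x : X => RKHS.kerFun H x 1)
include hc

/-- Expand the square. Convexity of the loss for each sample and quadratic growth at the minimizer
each supply one ηλ of the decrease, without differentiating the risk. -/
theorem integral_norm_sgdStep_sub_sq_le {lam η : ℝ} (hlam : 0 < lam) (hη : 0 ≤ η)
    (hηl : η * lam ≤ 1)
    {gmin : H} (hmin : IsMinOn (regRisk ρ lam) Set.univ gmin) {g : H} (hg : ‖g‖ ≤ 2 / lam) :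
    Integrable (fun z => ‖sgdStep lam η g z - gmin‖ ^ 2) ρ ∧
    ∫ z, ‖sgdStep lam η g z - gmin‖ ^ 2 ∂ρ
      ≤ (1 - 2 * (η * lam)) * ‖g - gmin‖ ^ 2 + 9 * η ^ 2 := by
  have hgl : lam * ‖g‖ ≤ 2 := by rwa [le_div_iff₀' hlam] at hg
  have hi1 := RKHS.integrable_logisticLoss (ρ := ρ) hc hk g
  have hi2 := RKHS.integrable_logisticLoss (ρ := ρ) hc hk gmin
  have hstep : Measurable fun z : X × Label => sgdStep lam η g z :=
    (measurable_sgdStep hc lam η).comp measurable_prodMk_left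
  have hi : Integrable (fun z => ‖sgdStep lam η g z - gmin‖ ^ 2) ρ := by
    refine Integrable.of_bound ((hstep.sub_const gmin).norm.pow_const 2).aestronglyMeasurable
      ((2 / lam + ‖gmin‖) ^ 2) (ae_of_all _ fun z => ?_)
    rw [norm_pow, norm_norm]
    have h1 := norm_sgdStep_le hk hη hηl (R := 2 / lam) (by field_simp; norm_num) hg z
    gcongr
    exact (norm_sub_le _ _).trans (by gcongr)
  refine ⟨hi, ?_⟩
  set C := ‖g - gmin‖ ^ 2 + 9 * η ^ 2
    - η * lam * (‖g‖ ^ 2 - ‖gmin‖ ^ 2 + ‖g - gmin‖ ^ 2) with hC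
  have hpt : ∀ z : X × Label, ‖sgdStep lam η g z - gmin‖ ^ 2
      ≤ C - 2 * η * (logisticLoss (g z.1) z.2 - logisticLoss (gmin z.1) z.2) := by
    intro z
    have h1 : sgdStep lam η g z - gmin = (g - gmin) - η • stochGrad lam g z := by
      rw [sgdStep]; abel
    -- On the ball of radius 2/λ the stochastic gradient has norm at most 1 + 2 = 3.
    have h2 : ‖stochGrad lam g z‖ ^ 2 ≤ 9 := by
      have h3 := norm_stochGrad_le hk hlam.le g z
      have h4 := norm_nonneg (stochGrad lam g z)
      nlinarith
    have h5 : ⟪g - gmin, stochGrad lam g z⟫_ℝ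
        = logisticLossDeriv (g z.1) z.2 * (g z.1 - gmin z.1)
          + lam / 2 * (‖g‖ ^ 2 - ‖gmin‖ ^ 2 + ‖g - gmin‖ ^ 2) := by
      rw [stochGrad, inner_add_right, real_inner_smul_right, ← RKHS.apply_eq_inner,
        real_inner_smul_right, RKHS.coe_sub, Pi.sub_apply, norm_sub_sq_real, inner_sub_left,
        real_inner_self_eq_norm_sq, real_inner_comm]
      ring
    have h6 := logisticLoss_tangent_le (g z.1) (gmin z.1) z.2
    rw [h1, norm_sub_sq_real, real_inner_smul_right, h5, norm_smul, mul_pow, Real.norm_eq_abs,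
      sq_abs]
    have h7 : η ^ 2 * ‖stochGrad lam g z‖ ^ 2 ≤ η ^ 2 * 9 := by gcongr
    have h8 := mul_le_mul_of_nonneg_left h6 hη
    rw [hC]
    linarith
  have hle := integral_mono hi ((integrable_const C).sub ((hi1.sub hi2).const_mul (2 * η))) hpt
  refine hle.trans ?_
  rw [integral_sub' (integrable_const C) ((hi1.sub hi2).const_mul (2 * η)), integral_const_mul,
    integral_sub' hi1 hi2]
  have h9 := mul_le_mul_of_nonneg_left (regRisk_isMinOn_add_sq_le hc hk hmin g) hη
  simp only [integral_const, probReal_univ, smul_eq_mul, one_mul]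
  unfold regRisk risk at h9
  rw [norm_sub_rev gmin g] at h9
  rw [hC]
  linarith

end SGDStep

/-! ### Sensitivity and bias of the conditional mean. -/

section FutureMeanBounds

variable {X H : Type*} [NormedAddCommGroup H] [InnerProductSpace ℝ H] [RKHS ℝ H X ℝ]
  [CompleteSpace H]

/-- The gradient step from the iterate `g_{s + 1}` to `g_{s + 2}`. -/
def sgdChain (lam γ : ℝ) (s : ℕ) : H → X × Label → H := sgdStep lam (learningRate lam γ (s + 1))

theorem learningRate_succ (lam γ : ℝ) (s : ℕ) :
    learningRate lam γ (s + 1) = 2 / (lam * (γ + s + 1)) := by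
  rw [learningRate]; push_cast; ring_nf

theorem learningRate_succ_mul {lam γ : ℝ} (hlam : 0 < lam) (s : ℕ) :
    learningRate lam γ (s + 1) * lam = 2 / (γ + s + 1) := by
  rw [learningRate_succ]
  field_simp

theorem learningRate_succ_nonneg {lam γ : ℝ} (hlam : 0 < lam) (hγ : 3 ≤ γ) (s : ℕ) :
    0 ≤ learningRate lam γ (s + 1) := by
  rw [learningRate_succ]; positivity

theorem learningRate_succ_mul_le {lam γ : ℝ} (hlam : 0 < lam) (hγ : 3 ≤ γ) (s : ℕ) :
    learningRate lam γ (s + 1) * lam ≤ 1 / 2 := by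
  rw [learningRate_succ_mul hlam, div_le_div_iff₀ (by positivity) (by norm_num)]
  have : (0 : ℝ) ≤ s := s.cast_nonneg
  linarith

/-- The Lipschitz constant of the future mean coming from the contraction `1 - η_t lam` of each
step, for averaging weights proportional to `γ + s`. -/
def sgdLipschitz (γ D : ℝ) : ℕ → ℕ → ℝ
  | 0, s => 2 * (γ + s) / D
  | r + 1, s => 2 * (γ + s) / D + (1 - 2 / (γ + s + 1)) * sgdLipschitz γ D r (s + 1)

/-- The additive error in the Lipschitz estimate of the future mean, caused by the early steps
whose learning rate is too large for them to be contractions. -/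
def sgdDefect (lam γ D : ℝ) : ℕ → ℕ → ℝ
  | 0, _ => 0
  | r + 1, s => sgdDefect lam γ D r (s + 1) + (if learningRate lam γ (s + 1) ≤ 1 then 0
      else learningRate lam γ (s + 1) * sgdLipschitz γ D r (s + 1))

variable {lam γ D : ℝ}

theorem two_div_le_one (hγ : 3 ≤ γ) (s : ℕ) : 2 / (γ + s + 1) ≤ 1 := by
  rw [div_le_one (by positivity)]
  have : (0 : ℝ) ≤ s := s.cast_nonneg
  linarith

theorem sgdLipschitz_nonneg (hγ : 3 ≤ γ) (hD : 0 < D) (r s : ℕ) : 0 ≤ sgdLipschitz γ D r s := by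
  induction r generalizing s with
  | zero => rw [sgdLipschitz]; positivity
  | succ r ih =>
    have h1 := ih (s + 1)
    have h2 : 0 ≤ 1 - 2 / (γ + s + 1) := by linarith [two_div_le_one hγ s]
    rw [sgdLipschitz]
    positivity

/-- The linear factor γ + s cancels against the learning rate, giving a main influence term uniform
in s. -/
theorem sgdLipschitz_le_mul_length (hγ : 3 ≤ γ) (hD : 0 < D) (r s : ℕ) :
    sgdLipschitz γ D r s ≤ 2 * (γ + s) * (r + 1) / D := by
  induction r generalizing s with
  | zero => rw [sgdLipschitz]; simp
  | succ r ih =>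
    have h1 := ih (s + 1)
    have h2 : 0 ≤ 1 - 2 / (γ + s + 1) := by linarith [two_div_le_one hγ s]
    have hs : (0 : ℝ) ≤ s := s.cast_nonneg
    rw [sgdLipschitz]
    push_cast at h1 ⊢
    calc _ ≤ 2 * (γ + s) / D + (1 - 2 / (γ + s + 1)) * (2 * (γ + (s + 1)) * (r + 1) / D) := by
          gcongr
      _ = (2 * (γ + s) + 2 * (γ + s - 1) * (r + 1)) / D := by
          field_simp
          ring
      _ ≤ _ := by
          gcongr
          nlinarith [show (0 : ℝ) ≤ r from r.cast_nonneg]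

/-- The product of contractions from s to j is (γ+s)(γ+s-1)/((γ+j)(γ+j-1)), so the weights 2(γ+j)
leave a sum of 1/(γ+j-1) ≤ 1/(j+1). Growth is thus only logarithmic in the horizon, as the early
steps require. -/
theorem sgdLipschitz_le_mul_harmonic (hγ : 3 ≤ γ) (hD : 0 < D) (r s : ℕ) :
    sgdLipschitz γ D r s
      ≤ 2 * (γ + s) * (γ + s - 1) * ((harmonic (s + r + 1) : ℝ) - harmonic s) / D := by
  induction r generalizing s with
  | zero =>
    have hs : (0 : ℝ) ≤ s := s.cast_nonneg
    rw [sgdLipschitz, add_zero, harmonic_succ]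
    push_cast
    have h1 : 1 ≤ (γ + s - 1) * ((s : ℝ) + 1)⁻¹ := by
      rw [← div_eq_mul_inv, one_le_div (by positivity)]
      linarith
    rw [add_sub_cancel_left, mul_assoc]
    exact div_le_div_of_nonneg_right (le_mul_of_one_le_right (by positivity) h1) hD.le
  | succ r ih =>
    have h1 := ih (s + 1)
    have h2 : 0 ≤ 1 - 2 / (γ + s + 1) := by linarith [two_div_le_one hγ s]
    have hs : (0 : ℝ) ≤ s := s.cast_nonneg
    have h3 : 1 ≤ (γ + s - 1) * ((s : ℝ) + 1)⁻¹ := by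
      rw [← div_eq_mul_inv, one_le_div (by positivity)]
      linarith
    rw [sgdLipschitz]
    rw [show s + 1 + r + 1 = s + (r + 1) + 1 by ring, harmonic_succ s] at h1
    set h : ℝ := (harmonic (s + (r + 1) + 1) : ℝ)
    push_cast at h1 ⊢
    calc _ ≤ 2 * (γ + s) / D + (1 - 2 / (γ + s + 1))
          * (2 * (γ + (s + 1)) * (γ + (s + 1) - 1) * (h - (harmonic s + ((s : ℝ) + 1)⁻¹)) / D) := by
          gcongr
      _ = (2 * (γ + s) * 1 + 2 * (γ + s) * (γ + s - 1)
            * (h - (harmonic s + ((s : ℝ) + 1)⁻¹))) / D := by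
          have : γ + s + 1 ≠ 0 := by positivity
          generalize (h - (harmonic s + ((s : ℝ) + 1)⁻¹)) = q
          field_simp
          ring
      _ ≤ (2 * (γ + s) * ((γ + s - 1) * ((s : ℝ) + 1)⁻¹) + 2 * (γ + s) * (γ + s - 1)
            * (h - (harmonic s + ((s : ℝ) + 1)⁻¹))) / D := by
          gcongr
      _ = _ := by ring

theorem harmonic_cast_mono {m n : ℕ} (h : m ≤ n) : (harmonic m : ℝ) ≤ harmonic n := by
  induction n, h using Nat.le_induction with
  | base => exact le_rfl
  | succ n _ ih =>
    rw [harmonic_succ]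
    push_cast
    have : (0 : ℝ) ≤ ((n : ℝ) + 1)⁻¹ := by positivity
    linarith

/-- A rate above 1 means γ + s + 1 < 2/λ, so at most max(0, 2/λ - γ - s) such steps remain, and each
costs at most the first factor. -/
theorem sgdDefect_le (hlam : 0 < lam) (hγ : 3 ≤ γ) (hD : 0 < D) {M r s : ℕ} (hM : s + r ≤ M) :
    sgdDefect lam γ D r s
      ≤ 8 * harmonic M / (lam ^ 2 * D) * max 0 (2 / lam - γ - s) := by
  have hh : ∀ n : ℕ, (0 : ℝ) ≤ harmonic n := fun n => by
    simpa using harmonic_cast_mono (Nat.zero_le n)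
  have hβ : (0 : ℝ) ≤ 8 * harmonic M / (lam ^ 2 * D) := by
    have := hh M
    positivity
  induction r generalizing s with
  | zero =>
    rw [sgdDefect]
    exact mul_nonneg hβ (le_max_left _ _)
  | succ r ih =>
    have h1 := ih (s := s + 1) (by omega)
    have hs : (0 : ℝ) ≤ s := s.cast_nonneg
    rw [sgdDefect]
    push_cast at h1
    split_ifs with h
    · rw [add_zero]
      refine h1.trans (mul_le_mul_of_nonneg_left (max_le_max le_rfl ?_) hβ)
      linarith
    · push Not at h
      rw [learningRate_succ, one_lt_div (by positivity)] at h
      have h2 : γ + s + 1 < 2 / lam := by rwa [lt_div_iff₀' hlam]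
      have h3 : learningRate lam γ (s + 1) * sgdLipschitz γ D r (s + 1)
          ≤ 8 * harmonic M / (lam ^ 2 * D) := by
        have h4 := sgdLipschitz_le_mul_harmonic hγ hD r (s + 1)
        have h5 := harmonic_cast_mono (show s + 1 + r ≤ M by omega)
        -- The index exceeds M by at most one; the extra term, at most 1, is paid for by subtracting
        -- at least H₁ = 1.
        have h6 : (harmonic (s + 1 + r + 1) : ℝ) - harmonic (s + 1) ≤ harmonic M := by
          have h7 := harmonic_cast_mono (show 1 ≤ s + 1 by omega)
          have h8 : (harmonic 1 : ℝ) = 1 := by simp [harmonic]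
          have h9 : (((s + 1 + r : ℕ) : ℝ) + 1)⁻¹ ≤ 1 := inv_le_one_of_one_le₀ (by
            linarith [show (0 : ℝ) ≤ ((s + 1 + r : ℕ) : ℝ) from Nat.cast_nonneg _])
          rw [harmonic_succ (s + 1 + r)]
          push_cast at h9 ⊢
          linarith
        push_cast at h4
        rw [learningRate_succ]
        calc _ ≤ 2 / (lam * (γ + s + 1)) * (2 * (γ + (s + 1)) * (γ + (s + 1) - 1)
              * harmonic M / D) := by
              gcongr
              refine h4.trans ?_
              gcongr
              · have : 0 ≤ γ + (s + 1) - 1 := by linarith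
                positivity
          _ = 4 * harmonic M / (lam * D) * (γ + s) := by
              field_simp
              ring
          _ ≤ 4 * harmonic M / (lam * D) * (2 / lam) := by
              have := hh M
              gcongr
              linarith
          _ = _ := by
              field_simp
              ring
      have h4 : max 0 (2 / lam - γ - (s + 1)) + 1 ≤ max 0 (2 / lam - γ - s) := by
        rw [max_eq_right (by linarith), max_eq_right (by linarith)]
        linarith
      nlinarith

variable (hk : ∀ x : X, ‖RKHS.kerFun H x 1‖ ≤ 1) [TopologicalSpace X] [MeasurableSpace X]
  [OpensMeasurableSpace X]
  [SecondCountableTopology X] [MeasurableSpace H] [BorelSpace H] [SecondCountableTopology H]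
  {ρ : Measure (X × Label)} [IsProbabilityMeasure ρ]
  (hc : Continuous fun x : X => RKHS.kerFun H x 1) {w : ℕ → ℝ} (hw : ∀ s, w s = 2 * (γ + s) / D)
include hk hc hw

theorem norm_futureMean_sgdChain_sub_le (hlam : 0 < lam) (hγ : 3 ≤ γ) (hD : 0 < D) (r s : ℕ)
    (g g' : H) :
    ‖futureMean ρ (sgdChain lam γ) w r s g - futureMean ρ (sgdChain lam γ) w r s g'‖
      ≤ sgdLipschitz γ D r s * ‖g - g'‖ + sgdDefect lam γ D r s := by
  have hstep := fun s => measurable_sgdStep (H := H) hc lam (learningRate lam γ (s + 1))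
  induction r generalizing s g g' with
  | zero =>
    rw [futureMean_zero, futureMean_zero, ← smul_sub, norm_smul, hw, sgdLipschitz, sgdDefect,
      add_zero, Real.norm_of_nonneg (by positivity)]
  | succ r ih =>
    set F := futureMean ρ (sgdChain (H := H) lam γ) w r (s + 1) with hF
    set η := learningRate lam γ (s + 1) with hη
    have hA := sgdLipschitz_nonneg hγ hD r (s + 1)
    have hη0 : 0 ≤ η := learningRate_succ_nonneg hlam hγ s
    have hηl : η * lam ≤ 1 / 2 := learningRate_succ_mul_le hlam hγ s
    have hηl' : η * lam = 2 / (γ + s + 1) := learningRate_succ_mul hlam s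
    have hFi : ∀ g, Integrable (fun z => F (sgdChain lam γ s g z)) ρ := fun g =>
      integrable_of_dist_le (((measurable_futureMean hstep r (s + 1)).comp (hstep s)).comp
        measurable_prodMk_left)
        (c := sgdLipschitz γ D r (s + 1) * (2 * η) + sgdDefect lam γ D r (s + 1)) fun z z' =>
        (ih (s + 1) _ _).trans (by
          gcongr
          exact norm_sgdStep_sub_sgdStep_sample_le hk lam hη0 g z z')
    have hdiff : ∀ z, ‖F (sgdChain lam γ s g z) - F (sgdChain lam γ s g' z)‖
        ≤ (1 - 2 / (γ + s + 1)) * sgdLipschitz γ D r (s + 1) * ‖g - g'‖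
          + sgdDefect lam γ D (r + 1) s := by
      intro z
      refine (ih (s + 1) _ _).trans ?_
      rw [sgdDefect, ← hη, ← hηl']
      split_ifs with h
      · have := mul_le_mul_of_nonneg_left
          (norm_sgdStep_sub_sgdStep_le hk hη0 h hηl g g' z) hA
        unfold sgdChain
        linarith
      · have := mul_le_mul_of_nonneg_left
          (norm_sgdStep_sub_sgdStep_le_add hk hη0 (by linarith : η * lam ≤ 1) g g' z) hA
        unfold sgdChain
        linarith
    rw [futureMean_succ, futureMean_succ, add_sub_add_comm, ← smul_sub,
      ← integral_sub (hFi g) (hFi g'), sgdLipschitz]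
    have h1 := norm_integral_le_of_norm_le_const (ae_of_all ρ hdiff)
    rw [probReal_univ, mul_one] at h1
    refine (norm_add_le _ _).trans ?_
    rw [norm_smul, hw, Real.norm_of_nonneg (by positivity)]
    linarith

theorem norm_futureMean_sgdChain_sample_sub_le (hlam : 0 < lam) (hγ : 3 ≤ γ) (hD : 0 < D)
    (r s : ℕ) (g : H) (z z' : X × Label) :
    ‖futureMean ρ (sgdChain lam γ) w r (s + 1) (sgdChain lam γ s g z)
        - futureMean ρ (sgdChain lam γ) w r (s + 1) (sgdChain lam γ s g z')‖
      ≤ sgdLipschitz γ D r (s + 1) * (2 * learningRate lam γ (s + 1))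
        + sgdDefect lam γ D r (s + 1) := by
  have hA := sgdLipschitz_nonneg hγ hD r (s + 1)
  refine (norm_futureMean_sgdChain_sub_le hk hc hw hlam hγ hD r (s + 1) _ _).trans ?_
  gcongr
  exact norm_sgdStep_sub_sgdStep_sample_le hk lam (learningRate_succ_nonneg hlam hγ s) g z z'

/-- The coefficient of `gmin` is the total weight of times s to s + r. Backward induction: Jensen
passes the square through the expectation, Cauchy–Schwarz merges the current weight with the later
ones, and the one-step inequality updates the bound. -/
theorem norm_futureMean_sgdChain_sub_smul_sq_le (hlam : 0 < lam) (hγ : 3 ≤ γ) (hD : 0 < D)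
    {gmin : H} (hmin : IsMinOn (regRisk ρ lam) Set.univ gmin) (r s : ℕ) {g : H}
    (hg : ‖g‖ ≤ 2 / lam) :
    ‖futureMean ρ (sgdChain lam γ) w r s g - ((r + 1) * (2 * γ + 2 * s + r) / D) • gmin‖ ^ 2
      ≤ (r + 1) * (2 * γ + 2 * s + r) / D * ((γ + s) * (γ + s - 1) / D * ‖g - gmin‖ ^ 2
        + 36 * (r + 1) / (lam ^ 2 * D)) := by
  have hstep := fun s => measurable_sgdStep (H := H) hc lam (learningRate lam γ (s + 1))
  induction r generalizing s g with
  | zero =>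
    have hs : (0 : ℝ) ≤ s := s.cast_nonneg
    have h1 : ((0 : ℕ) + 1 : ℝ) * (2 * γ + 2 * s + (0 : ℕ)) / D = w s := by
      rw [hw]; push_cast; ring
    rw [h1, futureMean_zero, ← smul_sub, norm_smul, mul_pow, Real.norm_eq_abs, sq_abs, hw]
    have h2 : 2 * (γ + s) / D ≤ (γ + s) * (γ + s - 1) / D := by
      refine div_le_div_of_nonneg_right ?_ hD.le
      nlinarith
    have h3 : 0 ≤ 36 * ((0 : ℕ) + 1 : ℝ) / (lam ^ 2 * D) := by positivity
    have h4 : 0 ≤ 2 * (γ + s) / D := by positivity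
    rw [sq (2 * (γ + s) / D), mul_assoc]
    gcongr
    have h5 := mul_le_mul_of_nonneg_right h2 (sq_nonneg ‖g - gmin‖)
    linarith
  | succ r ih =>
    have hs : (0 : ℝ) ≤ s := s.cast_nonneg
    have hr : (0 : ℝ) ≤ r := r.cast_nonneg
    set F := futureMean ρ (sgdChain (H := H) lam γ) w r (s + 1) with hF
    set η := learningRate lam γ (s + 1) with hη
    have hη0 : 0 ≤ η := learningRate_succ_nonneg hlam hγ s
    have hηl : η * lam ≤ 1 / 2 := learningRate_succ_mul_le hlam hγ s
    have hηl' : η * lam = 2 / (γ + s + 1) := learningRate_succ_mul hlam s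
    set β' : ℝ := (r + 1) * (2 * γ + 2 * (s + 1) + r) / D with hβ'
    have hβ'0 : 0 < β' := by positivity
    set p' : ℝ := (γ + (s + 1)) * (γ + (s + 1) - 1) / D with hp'
    have hp'0 : 0 ≤ p' := div_nonneg (mul_nonneg (by linarith) (by linarith)) hD.le
    set q' : ℝ := 36 * (r + 1) / (lam ^ 2 * D) with hq'
    have hw0 : 0 ≤ w s := by rw [hw]; positivity
    have hFi : Integrable (fun z => F (sgdChain lam γ s g z)) ρ :=
      integrable_of_dist_le (((measurable_futureMean hstep r (s + 1)).comp (hstep s)).comp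
        measurable_prodMk_left) fun z z' =>
        norm_futureMean_sgdChain_sample_sub_le hk hc hw hlam hγ hD r s g z z'
    obtain ⟨hi, hle⟩ := integral_norm_sgdStep_sub_sq_le hk hc hlam hη0 (by linarith) hmin hg
    have hpt : ∀ z, ‖F (sgdChain lam γ s g z) - β' • gmin‖ ^ 2
        ≤ β' * (p' * ‖sgdStep lam η g z - gmin‖ ^ 2 + q') := by
      intro z
      have h1 := ih (s + 1) (norm_sgdStep_le (lam := lam) hk hη0 (by linarith) (R := 2 / lam)
        (by field_simp; norm_num) hg z)
      push_cast at h1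
      exact h1
    have hsq : ‖∫ z, (F (sgdChain lam γ s g z) - β' • gmin) ∂ρ‖ ^ 2
        ≤ β' * (p' * ((1 - 2 * (η * lam)) * ‖g - gmin‖ ^ 2 + 9 * η ^ 2) + q') := by
      have hFi' := hFi.sub (integrable_const (β' • gmin))
      have hbound : Integrable (fun z => β' * (p' * ‖sgdStep lam η g z - gmin‖ ^ 2 + q')) ρ :=
        ((hi.const_mul p').add (integrable_const q')).const_mul β'
      have hsqi : Integrable (fun z => ‖F (sgdChain lam γ s g z) - β' • gmin‖ ^ 2) ρ :=
        hbound.mono' (hFi'.aestronglyMeasurable.norm.pow 2) (ae_of_all _ fun z => by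
          rw [norm_pow, norm_norm]; exact hpt z)
      calc _ ≤ ∫ z, ‖F (sgdChain lam γ s g z) - β' • gmin‖ ^ 2 ∂ρ :=
            ConvexOn.map_integral_le (g := fun v : H => ‖v‖ ^ 2) (s := Set.univ)
              ((convexOn_norm convex_univ).pow (fun _ _ => norm_nonneg _) 2)
              (by fun_prop) isClosed_univ (by simp) hFi' hsqi
        _ ≤ ∫ z, β' * (p' * ‖sgdStep lam η g z - gmin‖ ^ 2 + q') ∂ρ :=
            integral_mono hsqi hbound hpt
        _ ≤ _ := by
            rw [integral_const_mul, integral_add (hi.const_mul p') (integrable_const q'),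
              integral_const_mul]
            simp only [integral_const, probReal_univ, smul_eq_mul, one_mul]
            gcongr
    set Y := p' * ((1 - 2 * (η * lam)) * ‖g - gmin‖ ^ 2 + 9 * η ^ 2) + q' with hY
    set I := ‖∫ z, (F (sgdChain lam γ s g z) - β' • gmin) ∂ρ‖ with hI
    set a := ‖g - gmin‖ with ha
    have hβ : ((r + 1 : ℕ) + 1 : ℝ) * (2 * γ + 2 * s + (r + 1 : ℕ)) / D = w s + β' := by
      rw [hw, hβ']; push_cast; ring
    have hsplit : ‖futureMean ρ (sgdChain lam γ) w (r + 1) s g - (w s + β') • gmin‖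
        ≤ w s * a + I := by
      have : futureMean ρ (sgdChain lam γ) w (r + 1) s g - (w s + β') • gmin
          = w s • (g - gmin) + ∫ z, (F (sgdChain lam γ s g z) - β' • gmin) ∂ρ := by
        rw [futureMean_succ, integral_sub hFi (integrable_const _), integral_const, probReal_univ,
          one_smul, add_smul, smul_sub]
        abel
      rw [this]
      refine (norm_add_le _ _).trans_eq ?_
      rw [norm_smul, Real.norm_of_nonneg hw0]
    have hcs : (w s * a + I) ^ 2 ≤ (w s + β') * (w s * a ^ 2 + Y) := by
      have h1 : 0 ≤ β' * (β' * a ^ 2 + Y - 2 * a * I) := by nlinarith [sq_nonneg (β' * a - I)]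
      have h2 : 0 ≤ β' * a ^ 2 + Y - 2 * a * I := nonneg_of_mul_nonneg_right h1 hβ'0
      nlinarith [mul_nonneg hw0 h2]
    have hfin : w s * a ^ 2 + Y
        ≤ (γ + s) * (γ + s - 1) / D * a ^ 2 + 36 * ((r + 1 : ℕ) + 1) / (lam ^ 2 * D) := by
      -- The identity behind the weights: with k = γ + s, 2k + (k+1)k(1 - 4/(k+1)) = k(k-1), so the
      -- distance coefficients telescope.
      have h1 : w s + p' * (1 - 2 * (η * lam)) = (γ + s) * (γ + s - 1) / D := by
        rw [hw, hp', hηl']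
        have : γ + s + 1 ≠ 0 := by positivity
        field_simp
        ring
      have h2 : p' * (9 * η ^ 2) ≤ 36 / (lam ^ 2 * D) := by
        have h3 : p' * (9 * η ^ 2) = 36 / (lam ^ 2 * D) * ((γ + s) / (γ + s + 1)) := by
          rw [hp', hη, learningRate_succ]
          have : γ + s + 1 ≠ 0 := by positivity
          field_simp
          ring
        rw [h3]
        exact mul_le_of_le_one_right (by positivity)
          (div_le_one_of_le₀ (by linarith) (by positivity))
      have h4 : q' + 36 / (lam ^ 2 * D) = 36 * ((r + 1 : ℕ) + 1) / (lam ^ 2 * D) := by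
        rw [hq']; push_cast; ring
      rw [← h1, ← h4, hY]
      linarith
    rw [hβ]
    calc _ ≤ (w s * a + I) ^ 2 := by gcongr
      _ ≤ _ := hcs
      _ ≤ _ := by gcongr

end FutureMeanBounds

/-! ### Smallness of λ and the sum of squared influences. -/

section Constants

/-- With x = y², the right side is (λy)⁵y ≥ c⁵y, while y ≥ c/λ is large; a linear function beats the
squared logarithm. -/
theorem exists_pos_forall_log_sq_le {c : ℝ} (hc : 0 < c) :
    ∃ lam₀ : ℝ, 0 < lam₀ ∧ ∀ lam : ℝ, 0 < lam → lam ≤ lam₀ → ∀ x : ℝ, c ^ 2 ≤ lam ^ 2 * x →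
      10 * (1 + Real.log x) ^ 2 ≤ lam ^ 5 * x ^ 3 := by
  have h1 := (Real.isLittleO_pow_log_id_atTop (n := 2)).def (show 0 < c ^ 5 / 90 by positivity)
  have h2 := Real.tendsto_log_atTop.eventually_ge_atTop 1
  obtain ⟨Y, hY⟩ := Filter.eventually_atTop.1 (h1.and h2)
  have hY0 : 0 < max Y 1 := lt_max_of_lt_right one_pos
  refine ⟨c / max Y 1, by positivity, fun lam hlam hle x hx => ?_⟩
  have hx0 : 0 < x := by
    by_contra! h
    nlinarith [sq_nonneg lam, pow_pos hc 2]
  obtain ⟨y, hy0, rfl⟩ : ∃ y : ℝ, 0 < y ∧ y ^ 2 = x :=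
    ⟨√x, Real.sqrt_pos.2 hx0, Real.sq_sqrt hx0.le⟩
  have hcy : c ≤ lam * y := by
    rw [← mul_pow] at hx
    exact le_of_sq_le_sq hx (by positivity)
  have hYy : max Y 1 ≤ y := by
    rw [le_div_iff₀ hY0] at hle
    exact le_of_mul_le_mul_left (hle.trans hcy) hlam
  obtain ⟨h3, h4⟩ := hY y ((le_max_left _ _).trans hYy)
  rw [Real.norm_of_nonneg (sq_nonneg _), id, Real.norm_of_nonneg hy0.le] at h3
  rw [Real.log_pow]
  push_cast
  calc 10 * (1 + 2 * Real.log y) ^ 2 ≤ 10 * (3 * Real.log y) ^ 2 := by gcongr; linarith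
    _ ≤ c ^ 5 * y := by linarith
    _ ≤ (lam * y) ^ 5 * y := by gcongr
    _ = _ := by ring

/-- A bound for the influence of the sample of step `s` on the averaged iterate. -/
def sgdInfluence (lam γ : ℝ) (T s : ℕ) : ℝ :=
  8 / (lam * (2 * γ + T)) + if (s : ℝ) < 2 / lam - γ then
    16 * harmonic T / (lam ^ 3 * ((2 * γ + T) * (T + 1))) else 0

variable {lam γ : ℝ} {T : ℕ}

theorem sgdLipschitz_mul_add_sgdDefect_le (hlam : 0 < lam) (hγ : 3 ≤ γ) {r s : ℕ}
    (h : s + r + 1 = T) :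
    sgdLipschitz γ ((2 * γ + T) * (T + 1)) r (s + 1) * (2 * learningRate lam γ (s + 1))
      + sgdDefect lam γ ((2 * γ + T) * (T + 1)) r (s + 1) ≤ sgdInfluence lam γ T s := by
  have hD : 0 < (2 * γ + T) * (T + 1 : ℝ) := by positivity
  have hh : (0 : ℝ) ≤ harmonic T := by simpa using harmonic_cast_mono (Nat.zero_le T)
  have hη := learningRate_succ_nonneg hlam hγ s
  refine add_le_add ?_ ?_
  · have h1 := sgdLipschitz_le_mul_length hγ hD r (s + 1)
    push_cast at h1
    calc _ ≤ 2 * (γ + (s + 1)) * (r + 1) / ((2 * γ + T) * (T + 1))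
          * (2 * learningRate lam γ (s + 1)) := by gcongr
      _ = 8 / (lam * (2 * γ + T)) * ((r + 1) / (T + 1)) := by
          rw [learningRate_succ]
          have : γ + s + 1 ≠ 0 := by positivity
          field_simp
          ring
      _ ≤ _ := by
          refine mul_le_of_le_one_right (by positivity) (div_le_one_of_le₀ ?_ (by positivity))
          have : r ≤ T := by omega
          gcongr
  · refine (sgdDefect_le hlam hγ hD (M := T) (by omega)).trans ?_
    push_cast
    split_ifs with hs
    · calc _ ≤ 8 * harmonic T / (lam ^ 2 * ((2 * γ + T) * (T + 1))) * (2 / lam) := by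
            gcongr
            refine max_le (by positivity) ?_
            linarith [show (0 : ℝ) ≤ s from s.cast_nonneg]
        _ = _ := by
            field_simp
            ring
    · rw [max_eq_left (by linarith), mul_zero]

/-- By (a + b)² ≤ 2a² + 2b², the uniform part contributes 128 and the at most 3/λ early steps
contribute 768/5 ≤ 154, in units of 1/(λ²(2γ+T)). -/
theorem sum_sgdInfluence_sq_le (hlam : 0 < lam) (hlam1 : lam ≤ 1) (hγ : 3 ≤ γ)
    (hsmall : γ < 2 / lam → 10 * (harmonic T : ℝ) ^ 2 ≤ lam ^ 5 * (2 * γ + T) * (T + 1) ^ 2) :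
    ∑ s ∈ Finset.range T, sgdInfluence lam γ T s ^ 2 ≤ 288 / (lam ^ 2 * (2 * γ + T)) := by
  have hN : 0 < 2 * γ + T := by positivity
  set a := 8 / (lam * (2 * γ + T)) with ha
  set b := 16 * (harmonic T : ℝ) / (lam ^ 3 * ((2 * γ + T) * (T + 1))) with hb
  have h1 : ∀ s : ℕ, sgdInfluence lam γ T s ^ 2
      ≤ 2 * a ^ 2 + if (s : ℝ) < 2 / lam - γ then 2 * b ^ 2 else 0 := fun s => by
    unfold sgdInfluence
    split_ifs
    · nlinarith [sq_nonneg (a - b)]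
    · nlinarith [sq_nonneg a]
  have h2 : ∑ s ∈ Finset.range T, (if (s : ℝ) < 2 / lam - γ then 2 * b ^ 2 else 0)
      ≤ 154 / (lam ^ 2 * (2 * γ + T)) := by
    rw [← Finset.sum_filter, Finset.sum_const, nsmul_eq_mul]
    by_cases hγl : γ < 2 / lam
    · have hcard : (((Finset.range T).filter fun s : ℕ => (s : ℝ) < 2 / lam - γ).card : ℝ)
          ≤ 3 / lam := by
        have hsub : ((Finset.range T).filter fun s : ℕ => (s : ℝ) < 2 / lam - γ)
            ⊆ Finset.range ⌈2 / lam⌉₊ := fun s hs => by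
          rw [Finset.mem_range, Nat.lt_ceil]
          linarith [(Finset.mem_filter.1 hs).2]
        have h3 : (((Finset.range T).filter fun s : ℕ => (s : ℝ) < 2 / lam - γ).card : ℝ)
            ≤ ⌈2 / lam⌉₊ := by
          have := Finset.card_le_card hsub
          rw [Finset.card_range] at this
          exact_mod_cast this
        have h4 := Nat.ceil_lt_add_one (show 0 ≤ 2 / lam by positivity)
        have h5 : 1 ≤ 1 / lam := by rwa [le_div_iff₀ hlam, one_mul]
        have h6 : 3 / lam = 2 / lam + 1 / lam := by ring
        linarith
      calc _ ≤ 3 / lam * (2 * b ^ 2) := by gcongr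
        _ = 768 / 5 * (10 * (harmonic T : ℝ) ^ 2)
            / (lam ^ 7 * ((2 * γ + T) ^ 2 * (T + 1) ^ 2)) := by
            rw [hb]
            field_simp
            ring
        _ ≤ 768 / 5 * (lam ^ 5 * (2 * γ + T) * (T + 1) ^ 2)
            / (lam ^ 7 * ((2 * γ + T) ^ 2 * (T + 1) ^ 2)) := by
            gcongr ?_ / _
            exact mul_le_mul_of_nonneg_left (hsmall hγl) (by norm_num)
        _ = 768 / 5 / (lam ^ 2 * (2 * γ + T)) := by
            field_simp
        _ ≤ _ := by
            gcongr
            norm_num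
    · have hempty : ((Finset.range T).filter fun s : ℕ => (s : ℝ) < 2 / lam - γ) = ∅ := by
        refine Finset.filter_eq_empty_iff.2 fun s _ hs => hγl ?_
        linarith [show (0 : ℝ) ≤ s from s.cast_nonneg]
      rw [hempty, Finset.card_empty, Nat.cast_zero, zero_mul]
      positivity
  have h3 : T * (2 * a ^ 2) ≤ 128 / (lam ^ 2 * (2 * γ + T)) := by
    have h4 : T * (2 * a ^ 2) = 128 / (lam ^ 2 * (2 * γ + T)) * (T / (2 * γ + T)) := by
      rw [ha]
      field_simp
      ring
    rw [h4]
    exact mul_le_of_le_one_right (by positivity)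
      (div_le_one_of_le₀ (by linarith) hN.le)
  calc _ ≤ ∑ s ∈ Finset.range T,
        (2 * a ^ 2 + if (s : ℝ) < 2 / lam - γ then 2 * b ^ 2 else 0) :=
        Finset.sum_le_sum fun s _ => h1 s
    _ ≤ 128 / (lam ^ 2 * (2 * γ + T)) + 154 / (lam ^ 2 * (2 * γ + T)) := by
        rw [Finset.sum_add_distrib, Finset.sum_const, Finset.card_range, nsmul_eq_mul]
        exact add_le_add h3 h2
    _ ≤ _ := by
        rw [← add_div]
        gcongr
        norm_num

/-- If γ < 2/λ, then 2γλ² < 4λ ≤ c², so half of the lower bound on λ²(2γ+T) falls on T alone. -/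
theorem harmonic_sq_le_of_log_sq_le (hlam : 0 < lam) (hγ : 3 ≤ γ) {c : ℝ}
    (hlog : ∀ x : ℝ, c ^ 2 ≤ lam ^ 2 * x → 10 * (1 + Real.log x) ^ 2 ≤ lam ^ 5 * x ^ 3)
    (hlamc : 4 * lam ≤ c ^ 2) (hN : 2 * c ^ 2 ≤ lam ^ 2 * (2 * γ + T)) (hγl : γ < 2 / lam) :
    10 * (harmonic T : ℝ) ^ 2 ≤ lam ^ 5 * (2 * γ + T) * (T + 1) ^ 2 := by
  have hT0 : (0 : ℝ) ≤ T := T.cast_nonneg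
  have h1 : lam * γ < 2 := by rwa [lt_div_iff₀' hlam] at hγl
  have h2 : c ^ 2 ≤ lam ^ 2 * T := by nlinarith
  have hh : (0 : ℝ) ≤ harmonic T := by simpa using harmonic_cast_mono (Nat.zero_le T)
  calc 10 * (harmonic T : ℝ) ^ 2 ≤ 10 * (1 + Real.log T) ^ 2 := by
        gcongr
        exact harmonic_le_one_add_log T
    _ ≤ lam ^ 5 * (T : ℝ) ^ 3 := hlog T h2
    _ = lam ^ 5 * T * (T : ℝ) ^ 2 := by ring
    _ ≤ _ := by
        gcongr
        · linarith
        · linarith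

end Constants

/-! ### From distance to excess classification error. -/

section ExcessError

variable {X : Type*} [MeasurableSpace X] {ρ : Measure (X × Label)} [IsProbabilityMeasure ρ]

omit [IsProbabilityMeasure ρ] in
theorem classError_eq_of_margin {f g h : X → ℝ} {m : ℝ}
    (hf : ∀ᵐ x ∂ρ.fst, (m < f x ∧ 0 < h x) ∨ (f x < -m ∧ h x < 0))
    (hg : ∀ x, |g x - f x| ≤ m) : classError ρ g = classError ρ h := by
  refine classError_congr ?_
  filter_upwards [hf] with x hx
  have h1 := abs_le.1 (hg x)
  rcases hx with ⟨h2, h3⟩ | ⟨h2, h3⟩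
  · rw [Real.sign_of_pos h3, Real.sign_of_pos (by linarith)]
  · rw [Real.sign_of_neg h3, Real.sign_of_neg (by linarith)]

theorem abs_classError_sub_le (f g : X → ℝ) : |classError ρ f - classError ρ g| ≤ 1 := by
  have h1 : 0 ≤ classError ρ f := measureReal_nonneg
  have h2 : 0 ≤ classError ρ g := measureReal_nonneg
  have h3 : classError ρ f ≤ 1 := measureReal_le_one
  have h4 : classError ρ g ≤ 1 := measureReal_le_one
  rw [abs_le]
  constructor <;> linarith

theorem integral_le_measureReal_of_le_one {Ω : Type*} [MeasurableSpace Ω] {P : Measure Ω}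
    [IsFiniteMeasure P] {f : Ω → ℝ} (hf : Integrable f P) {B : Set Ω} (hB : MeasurableSet B)
    (h1 : ∀ ω, f ω ≤ 1) (h0 : ∀ ω, ω ∉ B → f ω ≤ 0) : ∫ ω, f ω ∂P ≤ P.real B := by
  have h := integral_mono hf ((integrable_const (1 : ℝ)).indicator hB) (fun ω => by
    by_cases hω : ω ∈ B
    · simpa [hω] using h1 ω
    · simpa [hω] using h0 ω hω)
  refine h.trans_eq ?_
  rw [integral_indicator_const _ hB, smul_eq_mul, mul_one]

end ExcessError

end

/-! ### Assembly of the exponential bound. -/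

theorem corollary1
    -- the feature space, a subset of `ℝ^d`, and the law of the data
    {d : ℕ} (X : Set (EuclideanSpace ℝ (Fin d)))
    (ρ : Measure (X × Label)) [IsProbabilityMeasure ρ]
    -- the reproducing kernel Hilbert space of the Gaussian kernel on `X`
    (s : ℝ) (hs : 0 < s)
    (H : Type*) [NormedAddCommGroup H] [InnerProductSpace ℝ H] [CompleteSpace H] [RKHS ℝ H X ℝ]
    (hker : ∀ x x' : X, RKHS.kernel H x x' 1 =
      gaussianKernel s (x : EuclideanSpace ℝ (Fin d)) (x' : EuclideanSpace ℝ (Fin d)))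
    -- smoothness of the expected risk
    (L : ℝ) (hL : 0 < L) (hsmooth : RiskSmooth H ρ L)
    -- the marginal distribution has full support
    (hsupp : ρ.fst.support = Set.univ)
    -- strong low-noise condition
    (δ : ℝ) (hδ : δ ∈ Set.Ioo (0 : ℝ) (1 / 2))
    (hnoise : ∀ᵐ x ∂ρ.fst, δ < |condProbOne ρ x - 1 / 2|)
    -- the conditional probability takes values in `(0, 1)`
    (hcond : ∀ᵐ x ∂ρ.fst, condProbOne ρ x ∈ Set.Ioo (0 : ℝ) 1)
    -- a Bayes rule for the expected risk belongs to the hypothesis space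
    (hbayes : ∃ gstar : H, IsBayesRule ρ (gstar : X → ℝ)) :
    ∃ lam₀ : ℝ, 0 < lam₀ ∧ ∀ lam : ℝ, 0 < lam → lam ≤ lam₀ →
      (∃! gmin : H, IsMinOn (regRisk ρ lam) Set.univ gmin) ∧
      ∀ gmin : H, IsMinOn (regRisk ρ lam) Set.univ gmin →
      ∀ γ : ℝ, 0 < γ → learningRate lam γ 1 ≤ min (1 / L) (1 / (2 * lam)) →
      ∀ g₁ : H, ‖g₁‖ ≤ 2 * learningRate lam γ 1 + 1 / lam →
      ∀ T : ℕ,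
        max (36 / (lam ^ 2 * (2 * γ + T)))
            (γ * (γ - 1) * ‖g₁ - gmin‖ ^ 2 / ((2 * γ + T) * (T + 1)))
          ≤ Real.log ((1 + 2 * δ) / (1 - 2 * δ)) ^ 2 / 32 →
      -- the samples: independent random variables with law `ρ`
      ∀ {Ω : Type*} [MeasurableSpace Ω] (P : Measure Ω) [IsProbabilityMeasure P]
        (Z : ℕ → Ω → X × Label),
        (∀ t, Measurable (Z t)) → (∀ t, P.map (Z t) = ρ) → iIndepFun Z P →
        Integrable (fun ω => classError ρ
          (averagedSGD lam γ g₁ (fun t => Z t ω) T : H) - classError ρ (condMean ρ)) P ∧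
        ∫ ω, (classError ρ (averagedSGD lam γ g₁ (fun t => Z t ω) T : H)
            - classError ρ (condMean ρ)) ∂P
          ≤ 2 * Real.exp (-(lam ^ 2 * (2 * γ + T) / (2 ^ 10 * 9)
              * Real.log ((1 + 2 * δ) / (1 - 2 * δ)) ^ 2)) := by
  obtain ⟨gstar, hstar⟩ := hbayes
  have hk : ∀ x : X, ‖RKHS.kerFun H x 1‖ ≤ 1 := fun x =>
    (RKHS.norm_kerFun_eq_one_of_gaussian (ι := fun x : X => (x : EuclideanSpace ℝ (Fin d))) hker x).le
  have hc : Continuous fun x : X => RKHS.kerFun H x 1 :=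
    RKHS.continuous_kerFun_of_gaussian continuous_subtype_val hker
  obtain ⟨g₀, hg₀, hconv⟩ := exists_isBayesRule_forall_isMinOn_dist_le hc hk hstar
  have hmargin := hg₀.ae_margin (RKHS.abs_apply_le hk g₀) hcond hδ hnoise
  obtain ⟨hδ0, hδ1⟩ := hδ
  have hm : 0 < Real.log ((1 + 2 * δ) / (1 - 2 * δ)) :=
    Real.log_pos (by rw [one_lt_div (by linarith)]; linarith)
  set m := Real.log ((1 + 2 * δ) / (1 - 2 * δ)) with hmdef
  obtain ⟨lamA, hlamA, hA⟩ := hconv (m / 2) (by positivity)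
  -- The condition on T reads λ²(2γ+T) ≥ 1152/m² = 2(24/m)², which fixes c = 24/m; the bound 144/m²
  -- on λ is c²/4.
  obtain ⟨lamB, hlamB, hB⟩ := exists_pos_forall_log_sq_le (show 0 < 24 / m by positivity)
  refine ⟨min (min lamA lamB) (min 1 (144 / m ^ 2)), by positivity, fun lam hlam hle => ?_⟩
  obtain ⟨⟨hleA, hleB⟩, hle1, hlem⟩ : (lam ≤ lamA ∧ lam ≤ lamB) ∧ lam ≤ 1 ∧ lam ≤ 144 / m ^ 2 := by
    simpa only [le_min_iff] using hle
  refine ⟨existsUnique_isMinOn_regRisk hc hk hlam, ?_⟩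
  intro gmin hmin γ hγ0 hη g₁ hg₁ T hT Ω _ P _ Z hZm hZlaw hZi
  obtain ⟨hT1, hT2⟩ := max_le_iff.1 hT
  have hη1 : learningRate lam γ 1 ≤ 1 / (2 * lam) := hη.trans (min_le_right _ _)
  -- The bound η₁ ≤ 1/(2λ) says γ + 1 ≥ 4. It also places g₁ in the ball of radius 2/λ, which every
  -- step preserves.
  have hγ : 3 ≤ γ := by
    rw [learningRate, div_le_div_iff₀ (by positivity) (by positivity), Nat.cast_one] at hη1
    have : lam * 4 ≤ lam * (γ + 1) := by linarith
    linarith [le_of_mul_le_mul_left this hlam]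
  have hg₁' : ‖g₁‖ ≤ 2 / lam := by
    have h1 : 2 / lam = 2 * (1 / (2 * lam)) + 1 / lam := by field_simp; norm_num
    linarith
  have hN : 0 < 2 * γ + T := by positivity
  have hD : 0 < (2 * γ + T) * (T + 1 : ℝ) := by positivity
  let _ : MeasurableSpace H := borel H
  have : BorelSpace H := ⟨rfl⟩
  have : SecondCountableTopology H := RKHS.secondCountableTopology hc
  have hw : ∀ s : ℕ, avgWeight γ T (s + 1) = 2 * (γ + s) / ((2 * γ + T) * (T + 1)) := fun s => by
    rw [avgWeight]; push_cast; ring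
  set V := futureMean ρ (sgdChain (H := H) lam γ) (fun s => avgWeight γ T (s + 1)) T 0 g₁ with hV
  -- At s = 0 and r = T the weights sum to 1, and the squared bias is at most the sum of the two
  -- quantities in the maximum, hence at most 2·m²/32.
  have hbias : ‖V - gmin‖ ≤ m / 4 := by
    have h1 := norm_futureMean_sgdChain_sub_smul_sq_le hk hc hw hlam hγ hD hmin T 0 hg₁'
    have h2 : (T + 1 : ℝ) * (2 * γ + 2 * (0 : ℕ) + T) / ((2 * γ + T) * (T + 1)) = 1 := by
      rw [Nat.cast_zero, mul_zero, add_zero, mul_comm, div_self hD.ne']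
    have h3 : 36 * (T + 1 : ℝ) / (lam ^ 2 * ((2 * γ + T) * (T + 1)))
        = 36 / (lam ^ 2 * (2 * γ + T)) := by
      field_simp
    rw [h2, h3, one_smul, one_mul, Nat.cast_zero, add_zero, div_mul_eq_mul_div] at h1
    refine le_of_sq_le_sq ?_ (by positivity)
    linarith
  have hchain : ∀ s, Measurable fun p : H × (X × Label) => sgdChain lam γ s p.1 p.2 := fun s =>
    measurable_sgdStep hc lam _
  set S : ℕ → Ω → H := fun s ω => sgdIterate lam γ g₁ (fun t => Z t ω) s with hS
  have hsum : ∑ j ∈ Finset.range T, sgdInfluence lam γ T j ^ 2 ≤ 288 / (lam ^ 2 * (2 * γ + T)) := by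
    refine sum_sgdInfluence_sq_le hlam hle1 hγ
      (harmonic_sq_le_of_log_sq_le hlam hγ (hB lam hlam hleB) ?_ ?_)
    · calc 4 * lam ≤ 4 * (144 / m ^ 2) := by gcongr
        _ = (24 / m) ^ 2 := by ring
    · rw [div_le_iff₀ (by positivity)] at hT1
      rw [div_pow, ← mul_div_assoc, div_le_iff₀ (by positivity)]
      linarith
  have htail := measureReal_norm_weightedSum_sub_ge_le (S := S) (g₁ := g₁) hchain hZm hZlaw hZi
    (fun ω => rfl) (fun s ω => rfl)
    (fun r s h g z z' => (norm_futureMean_sgdChain_sample_sub_le hk hc hw hlam hγ hD r s g z z').trans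
      (sgdLipschitz_mul_add_sgdDefect_le hlam hγ h))
    (by positivity) hsum (show 0 ≤ m / 4 by positivity)
  have hSm : ∀ s, Measurable (S s) := fun s =>
    (measurable_iterate_iSup_comap hchain (S := S) (Z := Z) (fun ω => rfl) (fun s ω => rfl) s).mono
      (iSup₂_le fun i _ => (hZm i).comap_le) le_rfl
  have havg : ∀ ω, averagedSGD lam γ g₁ (fun t => Z t ω) T
      = ∑ j ∈ Finset.range (T + 1), avgWeight γ T (j + 1) • S j ω := fun ω => rfl
  have havgm : Measurable fun ω => averagedSGD lam γ g₁ (fun t => Z t ω) T := by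
    simp_rw [havg]
    exact Finset.measurable_sum _ fun j _ => (hSm j).const_smul _
  have hint : Integrable (fun ω => classError ρ
      (averagedSGD lam γ g₁ (fun t => Z t ω) T : H) - classError ρ (condMean ρ)) P :=
    Integrable.of_bound (((measurable_classError_coe (RKHS.measurable_uncurry_coe hc)).comp
      havgm).sub_const _).aestronglyMeasurable 1 (ae_of_all _ fun ω => abs_classError_sub_le _ _)
  refine ⟨hint, ?_⟩
  -- The constant in the exponent: 16·2·288 = 2¹⁰·9.
  have hexp : (m / 4) ^ 2 / (2 * (288 / (lam ^ 2 * (2 * γ + T))))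
      = lam ^ 2 * (2 * γ + T) / (2 ^ 10 * 9) * m ^ 2 := by
    field_simp
    norm_num
  rw [hexp] at htail
  refine (integral_le_measureReal_of_le_one hint (B := {ω | m / 4 ≤
    ‖averagedSGD lam γ g₁ (fun t => Z t ω) T - V‖})
    (measurableSet_le measurable_const (havgm.sub_const V).norm)
    (fun ω => (le_abs_self _).trans (abs_classError_sub_le _ _)) fun ω hω => ?_).trans htail
  have hω' : ‖averagedSGD lam γ g₁ (fun t => Z t ω) T - V‖ < m / 4 := not_le.1 hω
  have hclose : ‖averagedSGD lam γ g₁ (fun t => Z t ω) T - g₀‖ ≤ m := by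
    have h1 := hA lam hlam hleA gmin hmin
    have h2 := norm_sub_le_norm_sub_add_norm_sub (averagedSGD lam γ g₁ (fun t => Z t ω) T) V g₀
    have h3 := norm_sub_le_norm_sub_add_norm_sub V gmin g₀
    linarith
  rw [classError_eq_of_margin hmargin fun x => ?_, sub_self]
  have := RKHS.abs_apply_le hk (averagedSGD lam γ g₁ (fun t => Z t ω) T - g₀) x
  rw [RKHS.coe_sub] at this
  exact this.trans hclose
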